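/- **Theorem 5.1.** Let $d\in\{2,3\}$, let $D\subset\mathbb R^d$ be open, bounded and connected with $C^1$ boundary and unit outward normal $\mathbf n$, let $T>0$, $D_T=D\times(0,T)$ and $\mathbf f\in C^1(D_T;\mathbb R^d)$. Let $u\in C^1(D_T;\mathbb R^d)\cap C(\bar D\times[0,T];\mathbb R^d)$ with $\|\nabla u\|_{L^\infty(D_T)}<\infty$ and $p\in C(\bar D\times[0,T])$, with $p(\cdot,t)$ differentiable in $D$ for $0<t<T$, be a classical solution of the incompressible Euler equations $$u_t+(u\cdot\nabla)u+\nabla p=\mathbf f,\quad \operatorname{div}u=0\ \text{ in }D_T,\qquad u\cdot\mathbf n=0\ \text{ on }\partial D\times(0,T),\qquad u(\cdot,0)=\bar u\ \text{ in }D .$$ Let $k\ge1$ be an integer and let $u^*\in C^k(D_T;\mathbb R^d)\cap C(\bar D\times[0,T];\mathbb R^d)$, $p^*\in C^k(D_T)\cap C(\bar D\times[0,T])$ be arbitrary (for instance a physics-informed neural network with smooth activation function and any parameters), with residuals $$\mathcal R_u=u^*_t+(u^*\cdot\nabla)u^*+\nabla p^*-\mathbf f,\quad \mathcal R_{div}=\operatorname{div}u^*,\quad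 \mathcal R_{sb}=u^*\cdot\mathbf n|_{\partial D\times[0,T]},\quad \mathcal R_{tb}=u^*(\cdot,0)-\bar u .$$ Let three quadrature rules with nonnegative weights be given: $(w^{tb}_n,x_n)$, $1\le n\le N_{tb}$, with points in $D$; $(w^{sb}_n,z_n)$, $1\le n\le N_{sb}$, with points in $\partial D\times[0,T]$; $(w^{int}_n,y_n)$, $1\le n\le N_{int}$, with points in $D_T$ ($N_{tb},N_{sb},N_{int}\ge 1$). Assume that, with rates $\alpha_{tb},\alpha_{sb},\alpha_{int}>0$ and functions $C^{tb}_{quad},C^{sb}_{quad},C^{int}_{quad}:\mathbb R\to\mathbb R$, $$\Big|\int_D g\,dx-\sum_n w_n^{tb}g(x_n)\Big|\le C^{tb}_{quad}(\|g\|_{C^k})N_{tb}^{-\alpha_{tb}}\quad\text{for all } g\in C^k(D),$$ $$\Big|\int_0^T\!\!\int_{\partial D} g\,ds\,dt-\sum_n w_n^{sb}g(z_n)\Big|\le C^{sb}_{quad}(\|g\|_{C^k})N_{sb}^{-\alpha_{sb}}\quad\text{for all } g\in C^k(\partial D\times[0,T]),$$ $$\Big|\int_0^T\!\!\int_D g\,dx\,dt-\sum_n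 w_n^{int}g(y_n)\Big|\le C^{int}_{quad}(\|g\|_{C^{k-1}})N_{int}^{-\alpha_{int}}\quad\text{for all } g\in C^{k-1}(D_T).$$ Here $C^m(D)$ and $C^m(D_T)$ consist of the functions with continuous and bounded derivatives up to order $m$, and $C^m(\partial D\times[0,T])$ consists of the restrictions of such functions on $\mathbb R^d\times\mathbb R$, with the infimum of the norms of all extensions as its norm. Assume that $|\mathcal R_{tb}|^2\in C^k(D)$, $|\mathcal R_{sb}|^2\in C^k(\partial D\times[0,T])$ and $|\mathcal R_u|^2,|\mathcal R_{div}|^2\in C^{k-1}(D_T)$. Define the generalization error and the training errors by $$\mathcal E_G^2=\int_0^T\!\!\int_D\|u-u^*\|^2dx\,dt,\qquad (\mathcal E_T^{tb})^2=\sum_n w^{tb}_n|\mathcal R_{tb}(x_n)|^2,\qquad (\mathcal E_T^{sb})^2=\sum_n w^{sb}_n|\mathcal R_{sb}(z_n)|^2,$$ $$(\mathcal E_T^{u})^2=\sum_n w^{int}_n|\mathcal R_u(y_n)|^2,\qquad (\mathcal E_T^{div})^2=\sum_n w^{int}_n|\mathcal R_{div}(y_n)|^2 .$$ Then $$\begin{aligned}\mathcal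 E_G^2\le{}&\big(T+C_\infty T^2e^{C_\infty T}\big)\Big[(\mathcal E_T^{tb})^2+(\mathcal E_T^{u})^2+C_0T^{1/2}\big(\mathcal E_T^{div}+\mathcal E_T^{sb}\big)\Big]\\ &+\big(T+C_\infty T^2e^{C_\infty T}\big)\Big[K_{tb}N_{tb}^{-\alpha_{tb}}+K_uN_{int}^{-\alpha_{int}}+C_0T^{1/2}\Big(K_{div}^{1/2}N_{int}^{-\alpha_{int}/2}+K_{sb}^{1/2}N_{sb}^{-\alpha_{sb}/2}\Big)\Big],\end{aligned}$$ where $K_{tb}=C^{tb}_{quad}(\||\mathcal R_{tb}|^2\|_{C^k})$, $K_u=C^{int}_{quad}(\||\mathcal R_u|^2\|_{C^{k-1}})$, $K_{div}=C^{int}_{quad}(\||\mathcal R_{div}|^2\|_{C^{k-1}})$, $K_{sb}=C^{sb}_{quad}(\||\mathcal R_{sb}|^2\|_{C^k})$, $C_\infty=1+2C_d\|\nabla u\|_{L^\infty(D_T)}$ with a constant $C_d>0$ that depends only on $d$, and $$C_0=C\big(\|u\|_{C^0(\bar D\times[0,T])},\|u^*\|_{C^0(\bar D\times[0,T])},\|p\|_{C^0(\bar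 D\times[0,T])},\|p^*\|_{C^0(\bar D\times[0,T])}\big)$$ with a function $C\ge0$ of four real variables that depends only on $D$. -/

import Mathlib

open Set MeasureTheory
open scoped Topology

noncomputable section

namespace EulerPINN

/-- `ℝ^d` with its Euclidean norm. -/
abbrev Space (d : ℕ) : Type := EuclideanSpace ℝ (Fin d)

/-! ### Domains with `C^1` boundary, outward normal, surface measure -/

/-- In the ball `B(x₀, r)` the set `D` is the region strictly below the graph of a `C^1` function
over the hyperplane orthogonal to the unit vector `e`.  The function `γ` on that hyperplane is
written as a function on the whole space that does not depend on the coordinate along `e`. -/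
structure IsC1GraphAt {d : ℕ} (D : Set (Space d)) (x₀ : Space d) (r : ℝ) (e : Space d)
    (γ : Space d → ℝ) : Prop where
  radius_pos : 0 < r
  norm_dir : ‖e‖ = 1
  smooth : ContDiff ℝ 1 γ
  invariant : ∀ (x : Space d) (s : ℝ), γ (x + s • e) = γ x
  mem_iff : ∀ x ∈ Metric.ball x₀ r, x ∈ D ↔ inner ℝ x e < γ x

/-- The boundary of `D` is of class `C^1`: near each boundary point, `D` is one side of a
`C^1` graph. -/
def HasC1Boundary {d : ℕ} (D : Set (Space d)) : Prop :=
  ∀ x₀ ∈ frontier D, ∃ (r : ℝ) (e : Space d) (γ : Space d → ℝ), IsC1GraphAt D x₀ r e γ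

/-- `ν` is the unit outward normal of `D` at the boundary point `x`: the normalized gradient of
`y ↦ ⟪y, e⟫ - γ y`, where `D` is locally `{⟪y, e⟫ < γ y}`. -/
def IsOutwardUnitNormal {d : ℕ} (D : Set (Space d)) (x ν : Space d) : Prop :=
  x ∈ frontier D ∧ ∃ (r : ℝ) (e : Space d) (γ : Space d → ℝ),
    IsC1GraphAt D x r e γ ∧ ν = ‖e - gradient γ x‖⁻¹ • (e - gradient γ x)

open Classical in
/-- The unit outward normal field `𝐧` (zero where there is none). -/
def outwardNormal {d : ℕ} (D : Set (Space d)) (x : Space d) : Space d :=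
  if h : ∃ ν, IsOutwardUnitNormal D x ν then h.choose else 0

/-- The surface measure `ds` on `∂D`: the `(d-1)`-dimensional Hausdorff measure, normalized to
agree with Lebesgue measure on `(d-1)`-dimensional Euclidean spaces, restricted to `∂D`. -/
def surfaceMeasure {d : ℕ} (D : Set (Space d)) : Measure (Space d) :=
  (Measure.euclideanHausdorffMeasure (d - 1)).restrict (frontier D)

/-- The open space-time cylinder `D_T = D × (0,T)`; points are pairs `(x, t)`. -/
def cylinder {d : ℕ} (D : Set (Space d)) (T : ℝ) : Set (Space d × ℝ) := D ×ˢ Ioo 0 T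

/-- The closed space-time cylinder `closure D × [0,T]`. -/
def closedCylinder {d : ℕ} (D : Set (Space d)) (T : ℝ) : Set (Space d × ℝ) :=
  closure D ×ˢ Icc 0 T

/-- The lateral boundary `∂D × [0,T]`. -/
def lateral {d : ℕ} (D : Set (Space d)) (T : ℝ) : Set (Space d × ℝ) :=
  frontier D ×ˢ Icc 0 T

/-! ### Differential operators on space-time fields -/

/-- The spatial derivative `∇u (x,t)`, as the linear map `h ↦ (h · ∇)u (x,t)`. -/
def spaceDeriv {d : ℕ} (u : Space d × ℝ → Space d) (z : Space d × ℝ) : Space d →L[ℝ] Space d :=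
  fderiv ℝ (fun y => u (y, z.2)) z.1

/-- The time derivative `u_t (x,t)`. -/
def timeDeriv {d : ℕ} (u : Space d × ℝ → Space d) (z : Space d × ℝ) : Space d :=
  deriv (fun s => u (z.1, s)) z.2

/-- The spatial divergence `div u (x,t) = ∑ i, ∂u_i/∂x_i (x,t)`. -/
def divergence {d : ℕ} (u : Space d × ℝ → Space d) (z : Space d × ℝ) : ℝ :=
  ∑ i : Fin d, (spaceDeriv u z (EuclideanSpace.single i 1)) i

/-- The spatial gradient `∇p (x,t)` of a scalar field. -/
def spaceGrad {d : ℕ} (p : Space d × ℝ → ℝ) (z : Space d × ℝ) : Space d :=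
  gradient (fun y => p (y, z.2)) z.1

/-- `u_t + (u · ∇)u + ∇p`. -/
def eulerOperator {d : ℕ} (u : Space d × ℝ → Space d) (p : Space d × ℝ → ℝ)
    (z : Space d × ℝ) : Space d :=
  timeDeriv u z + spaceDeriv u z (u z) + spaceGrad p z

/-- `(u, p)` is a classical solution of the incompressible Euler equations on `D × (0,T)` with
forcing `f`, no-penetration boundary condition and initial data `u₀`. -/
structure IsClassicalSolution {d : ℕ} (D : Set (Space d)) (T : ℝ) (f : Space d × ℝ → Space d)
    (u₀ : Space d → Space d) (u : Space d × ℝ → Space d) (p : Space d × ℝ → ℝ) : Prop where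
  contDiffOn_velocity : ContDiffOn ℝ 1 u (cylinder D T)
  continuousOn_velocity : ContinuousOn u (closedCylinder D T)
  differentiable_pressure : ∀ z ∈ cylinder D T, DifferentiableAt ℝ (fun y => p (y, z.2)) z.1
  continuousOn_pressure : ContinuousOn p (closedCylinder D T)
  momentum : ∀ z ∈ cylinder D T, eulerOperator u p z = f z
  divergence_free : ∀ z ∈ cylinder D T, divergence u z = 0
  no_penetration : ∀ x ∈ frontier D, ∀ t ∈ Ioo 0 T, inner ℝ (u (x, t)) (outwardNormal D x) = 0
  initial : ∀ x ∈ D, u (x, 0) = u₀ x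

/-! ### Norms -/

/-- The norm of `C^0(closure D × [0,T])`. -/
def supNorm {d : ℕ} {F : Type*} [NormedAddCommGroup F] (D : Set (Space d)) (T : ℝ)
    (v : Space d × ℝ → F) : ℝ :=
  sSup ((fun z => ‖v z‖) '' closedCylinder D T)

/-- `‖∇u‖_{L^∞(D_T)}` for a velocity field whose spatial derivative is continuous and bounded on
the open set `D_T`. -/
def gradSupNorm {d : ℕ} (D : Set (Space d)) (T : ℝ) (u : Space d × ℝ → Space d) : ℝ :=
  sSup ((fun z => ‖spaceDeriv u z‖) '' cylinder D T)

/-- `g` is of class `C^m` on `S`, and all its derivatives of order at most `m` are bounded by `M`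
there. -/
def CkBoundedBy {V : Type*} [NormedAddCommGroup V] [NormedSpace ℝ V] (m : ℕ) (S : Set V)
    (g : V → ℝ) (M : ℝ) : Prop :=
  0 ≤ M ∧ ContDiffOn ℝ m g S ∧ ∀ j ≤ m, ∀ x ∈ S, ‖iteratedFDerivWithin ℝ j g S x‖ ≤ M

/-- `g ∈ C^m(S)` with finite norm, for an open set `S`. -/
def MemCk {V : Type*} [NormedAddCommGroup V] [NormedSpace ℝ V] (m : ℕ) (S : Set V)
    (g : V → ℝ) : Prop :=
  ∃ M, CkBoundedBy m S g M

/-- The `C^m(S)` norm, for an open set `S`: the largest supremum of a derivative of order at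
most `m`. -/
def ckNorm {V : Type*} [NormedAddCommGroup V] [NormedSpace ℝ V] (m : ℕ) (S : Set V)
    (g : V → ℝ) : ℝ :=
  sInf {M | CkBoundedBy m S g M}

/-- `g ∈ C^m(K)` for a set `K` such as `∂D × [0,T]`: on `K`, the function `g` agrees with a
function of class `C^m` on the ambient space (with bounded derivatives). -/
def MemCkRestr {V : Type*} [NormedAddCommGroup V] [NormedSpace ℝ V] (m : ℕ) (K : Set V)
    (g : V → ℝ) : Prop :=
  ∃ M G, EqOn G g K ∧ CkBoundedBy m univ G M

/-- The `C^m(K)` norm: the infimum of the `C^m` norms of the extensions to the ambient space. -/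
def ckNormRestr {V : Type*} [NormedAddCommGroup V] [NormedSpace ℝ V] (m : ℕ) (K : Set V)
    (g : V → ℝ) : ℝ :=
  sInf {M | ∃ G, EqOn G g K ∧ CkBoundedBy m univ G M}

/-! ### Residuals -/

/-- Velocity residual `u_t + (u · ∇)u + ∇p - f`. -/
def resVel {d : ℕ} (f : Space d × ℝ → Space d) (v : Space d × ℝ → Space d)
    (q : Space d × ℝ → ℝ) (z : Space d × ℝ) : Space d :=
  eulerOperator v q z - f z

/-- Divergence residual. -/
def resDiv {d : ℕ} (v : Space d × ℝ → Space d) (z : Space d × ℝ) : ℝ :=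
  divergence v z

/-- Spatial boundary residual `v · 𝐧`. -/
def resSb {d : ℕ} (D : Set (Space d)) (v : Space d × ℝ → Space d) (z : Space d × ℝ) : ℝ :=
  inner ℝ (v z) (outwardNormal D z.1)

/-- Temporal boundary residual `v(·,0) - u₀`. -/
def resTb {d : ℕ} (u₀ : Space d → Space d) (v : Space d × ℝ → Space d) (x : Space d) : Space d :=
  v (x, 0) - u₀ x

/-! ### Quadrature rules and errors -/

/-- A quadrature rule with `N ≥ 1` points in `S` and nonnegative weights. -/
structure QuadRule (V : Type*) (S : Set V) where
  /-- number of points -/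
  N : ℕ
  N_pos : 0 < N
  /-- quadrature points -/
  pt : Fin N → V
  pt_mem : ∀ n, pt n ∈ S
  /-- quadrature weights -/
  w : Fin N → ℝ
  w_nonneg : ∀ n, 0 ≤ w n

/-- `∑ n, w_n g(y_n)`. -/
def QuadRule.eval {V : Type*} {S : Set V} (Q : QuadRule V S) (g : V → ℝ) : ℝ :=
  ∑ n, Q.w n * g (Q.pt n)

/-- The training error `(∑ n, w_n |R(y_n)|²)^{1/2}` for a residual `R`. -/
def QuadRule.trainingError {V F : Type*} [NormedAddCommGroup F] {S : Set V} (Q : QuadRule V S)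
    (R : V → F) : ℝ :=
  Real.sqrt (Q.eval fun y => ‖R y‖ ^ 2)

/-- Quadrature error bound on `D` for `C^k` functions, with constant `C (‖g‖_{C^k})` and
rate `α`. -/
def QuadBoundTb {d : ℕ} (D : Set (Space d)) (k : ℕ) (Q : QuadRule (Space d) D)
    (C : ℝ → ℝ) (α : ℝ) : Prop :=
  ∀ g : Space d → ℝ, MemCk k D g →
    |(∫ x in D, g x) - Q.eval g| ≤ C (ckNorm k D g) * (Q.N : ℝ) ^ (-α)

/-- Quadrature error bound on `∂D × [0,T]` for `C^k` functions. -/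
def QuadBoundSb {d : ℕ} (D : Set (Space d)) (T : ℝ) (k : ℕ)
    (Q : QuadRule (Space d × ℝ) (lateral D T)) (C : ℝ → ℝ) (α : ℝ) : Prop :=
  ∀ g : Space d × ℝ → ℝ, MemCkRestr k (lateral D T) g →
    |(∫ t in (0 : ℝ)..T, ∫ x, g (x, t) ∂(surfaceMeasure D)) - Q.eval g|
      ≤ C (ckNormRestr k (lateral D T) g) * (Q.N : ℝ) ^ (-α)

/-- Quadrature error bound on `D × (0,T)` for `C^l` functions. -/
def QuadBoundInt {d : ℕ} (D : Set (Space d)) (T : ℝ) (l : ℕ)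
    (Q : QuadRule (Space d × ℝ) (cylinder D T)) (C : ℝ → ℝ) (α : ℝ) : Prop :=
  ∀ g : Space d × ℝ → ℝ, MemCk l (cylinder D T) g →
    |(∫ t in (0 : ℝ)..T, ∫ x in D, g (x, t)) - Q.eval g|
      ≤ C (ckNorm l (cylinder D T) g) * (Q.N : ℝ) ^ (-α)

/-- The generalization error `(∫_0^T ∫_D ‖u - v‖² dx dt)^{1/2}`. -/
def generalizationError {d : ℕ} (D : Set (Space d)) (T : ℝ) (u v : Space d × ℝ → Space d) : ℝ :=
  Real.sqrt (∫ t in (0 : ℝ)..T, ∫ x in D, ‖u (x, t) - v (x, t)‖ ^ 2)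

/-- The constant `C_∞ = 1 + 2 C_d ‖∇u‖_{L^∞(D_T)}`. -/
def cInfty {d : ℕ} (Cd : ℝ) (D : Set (Space d)) (T : ℝ) (u : Space d × ℝ → Space d) : ℝ :=
  1 + 2 * Cd * gradSupNorm D T u

end EulerPINN

end

/-! Write v = u* - u. Subtracting the momentum equations and testing with 2v gives the pointwise
balance ∂ₜ|v|² + div Φ = S, where Φ = |v|² u* + 2(p* - p) v and S = 2 v·R_u - 2 v·(v·∇)u + R_div
(|v|² + 2(p* - p)); see `EnergySetting.spaceDivergence_flux`. Because u·n = 0, the normal flux is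
R_sb (|v|² + 2(p* - p)) (`EnergySetting.inner_flux_outwardNormal`). The common factor is bounded
through the sup norms of the fields, so ∫|v|² obeys an integral inequality with rate 1 + 2‖∇u‖,
whose data are the squared L² norms of R_tb and R_u and the L¹ norms of R_div and R_sb. Grönwall
(`integral_le_of_le_add_mul_integral`), Cauchy–Schwarz (`integral_abs_spaceTime_le`) and the
quadrature bounds conclude.

The delicate point is the boundary term: the fields are differentiable only in the open cylinder,
and the boundary is only C¹. No exact divergence theorem is used. The balance is integrated against
cutoffs φ_n supported in D (`integral_mul_spaceDivergence`), chosen so that ∫ ∇φ_n·w is bounded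
uniformly in n and has a limit of size at most K ∫ |w·n| over ∂D (`exists_isCutoffSequence`). A
one-sided bound with K determined by D is enough, since C₀ may depend on D.

The construction is local (`chart_flux`). In a chart the cutoff is a smooth step of n times the
height below the graph. The shear that straightens the graph preserves volume, so the gradient of
the step concentrates on the graph as n grows (`tendsto_integral_boundary_layer`), and Lebesgue
measure of the hyperplane, pushed onto the graph, is at most surface measure (`map_graphMap_le`). -/

noncomputable section

namespace EulerPINN

open Filter Measure

/-! ### Coordinates straightening a graph, and concentration of boundary layers. -/

section GraphCoordinates

variable {d : ℕ} {e : Space d} {γ : Space d → ℝ}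

/-- The hyperplane orthogonal to `e`. -/
abbrev Hyperplane (e : Space d) : Submodule ℝ (Space d) := (ℝ ∙ e)ᗮ

/-- Parametrization of the graph of `γ` over the hyperplane orthogonal to `e`. -/
def graphMap (e : Space d) (γ : Space d → ℝ) (y : Hyperplane e) : Space d := y + γ y • e

lemma proj_add_inner_smul (he : ‖e‖ = 1) (x : Space d) :
    ((Hyperplane e).orthogonalProjectionOnto x : Space d) + inner ℝ x e • e = x := by
  have h := (ℝ ∙ e).starProjection_add_starProjection_orthogonal x
  rw [Submodule.starProjection_unit_singleton ℝ he, real_inner_comm, add_comm] at h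
  exact h

lemma proj_add_smul (y : Hyperplane e) (s : ℝ) :
    (Hyperplane e).orthogonalProjectionOnto ((y : Space d) + s • e) = y := by
  have h : (Hyperplane e).orthogonalProjectionOnto (s • e) = 0 := by
    rw [Submodule.orthogonalProjectionOnto_eq_zero_iff]
    exact (ℝ ∙ e).le_orthogonal_orthogonal
      (Submodule.smul_mem _ _ (Submodule.mem_span_singleton_self e))
  rw [map_add, h, add_zero, Submodule.orthogonalProjectionOnto_mem_subspace_eq_self]

lemma inner_coe_hyperplane (y : Hyperplane e) : inner ℝ (y : Space d) e = 0 := by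
  rw [real_inner_comm]
  exact Submodule.mem_orthogonal_singleton_iff_inner_right.1 y.2

lemma inner_add_smul (he : ‖e‖ = 1) (y : Hyperplane e) (s : ℝ) :
    inner ℝ ((y : Space d) + s • e) e = s := by
  rw [inner_add_left, inner_coe_hyperplane, inner_smul_left, real_inner_self_eq_norm_sq, he]
  simp

lemma measurePreserving_hyperplane_prod (he : ‖e‖ = 1) :
    MeasurePreserving (fun p : Hyperplane e × ℝ => (p.1 : Space d) + p.2 • e) := by
  have h1 := (LinearIsometryEquiv.toSpanUnitSingleton (𝕜 := ℝ) e he).measurePreserving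
  have h2 := (h1.prod (MeasurePreserving.id (volume : Measure (Hyperplane e)))).comp
    (Measure.measurePreserving_swap (μ := (volume : Measure (Hyperplane e)))
      (ν := (volume : Measure ℝ)))
  have h3 := ((WithLp.volume_preserving_toLp (ℝ ∙ e) (Hyperplane e)).comp h2)
  have h4 := (ℝ ∙ e).orthogonalDecomposition.symm.measurePreserving.comp h3
  convert h4 using 1
  · funext p
    simp [add_comm]
  · rfl

/-- On each line parallel to `e` the map is a reflection followed by a translation, so volume is
preserved however steep γ is. The second coordinate becomes the height of the graph above the point.
-/
lemma measurePreserving_graph_prod (he : ‖e‖ = 1) (hγ : Continuous γ) :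
    MeasurePreserving
      (fun p : Hyperplane e × ℝ => (p.1 : Space d) + (γ p.1 - p.2) • e) := by
  have h : MeasurePreserving (fun p : Hyperplane e × ℝ => (p.1, γ p.1 - p.2))
      (volume.prod volume) (volume.prod volume) :=
    (MeasurePreserving.id _).skew_product (g := fun (y : Hyperplane e) (s : ℝ) => γ y - s)
      (by fun_prop) (Eventually.of_forall fun y => (measurePreserving_sub_left volume (γ y)).map_eq)
  exact (measurePreserving_hyperplane_prod he).comp h

lemma finrank_hyperplane (he : ‖e‖ = 1) : Module.finrank ℝ (Hyperplane e) = d - 1 := by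
  have h := (ℝ ∙ e).finrank_add_finrank_orthogonal
  rw [finrank_span_singleton (by rintro rfl; simp at he), finrank_euclideanSpace_fin] at h
  change Module.finrank ℝ ((ℝ ∙ e)ᗮ : Submodule ℝ (Space d)) = d - 1
  omega

/-- Orthogonal projection is 1-Lipschitz and inverts the graph map, so projecting a subset of the
graph cannot increase its Hausdorff measure. The inequality replaces the area formula with density
√(1 + |∇γ|²). -/
lemma map_graphMap_le (he : ‖e‖ = 1) (hγ : Continuous γ) :
    (volume : Measure (Hyperplane e)).map (graphMap e γ) ≤ μHE[d - 1] := by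
  have hΦ : Continuous (graphMap e γ) := by unfold graphMap; fun_prop
  refine Measure.le_iff.2 fun A hA => ?_
  rw [Measure.map_apply hΦ.measurable hA, ← InnerProductSpace.euclideanHausdorffMeasure_eq_volume,
    finrank_hyperplane he]
  have hsub : graphMap e γ ⁻¹' A ⊆ (Hyperplane e).orthogonalProjectionOnto '' A :=
    fun y hy => ⟨_, hy, proj_add_smul y _⟩
  have hlip : LipschitzWith 1 (Hyperplane e).orthogonalProjectionOnto :=
    (Hyperplane e).lipschitzWith_orthogonalProjectionOnto
  refine (measure_mono hsub).trans ?_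
  simp only [euclideanHausdorffMeasure_def, Measure.smul_apply]
  have := hlip.hausdorffMeasure_image_le (d := ((d - 1 : ℕ) : ℝ)) (by positivity) A
  simp only [ENNReal.coe_one, ENNReal.one_rpow, one_mul] at this
  gcongr

/-- A smooth step that vanishes on `(-∞, 1/n]` and equals `1` on `[2/n, ∞)`. -/
def layer (n : ℕ) (τ : ℝ) : ℝ := Real.smoothTransition (n * τ - 1)

lemma contDiff_layer (n : ℕ) : ContDiff ℝ 1 (layer n) :=
  Real.smoothTransition.contDiff.comp (by fun_prop)

lemma layer_nonneg (n : ℕ) (τ : ℝ) : 0 ≤ layer n τ := Real.smoothTransition.nonneg _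

lemma layer_le_one (n : ℕ) (τ : ℝ) : layer n τ ≤ 1 := Real.smoothTransition.le_one _

lemma layer_eq_zero {n : ℕ} {τ : ℝ} (h : n * τ ≤ 1) : layer n τ = 0 :=
  Real.smoothTransition.zero_of_nonpos (by linarith)

lemma layer_eq_one {n : ℕ} {τ : ℝ} (h : 2 ≤ n * τ) : layer n τ = 1 :=
  Real.smoothTransition.one_of_one_le (by linarith)

lemma deriv_layer (n : ℕ) (τ : ℝ) :
    deriv (layer n) τ = n * deriv Real.smoothTransition (n * τ - 1) := by
  have h1 : HasDerivAt (fun τ : ℝ => (n : ℝ) * τ - 1) n τ := by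
    simpa using ((hasDerivAt_id τ).const_mul (n : ℝ)).sub_const 1
  have h2 : HasDerivAt Real.smoothTransition (deriv Real.smoothTransition (n * τ - 1))
      (n * τ - 1) :=
    ((Real.smoothTransition.contDiff (n := 1)).differentiable (by simp) _).hasDerivAt
  rw [mul_comm]
  exact (h2.comp τ h1).deriv

lemma deriv_layer_nonneg (n : ℕ) (τ : ℝ) : 0 ≤ deriv (layer n) τ := by
  rw [deriv_layer]
  exact mul_nonneg (Nat.cast_nonneg n) (Real.smoothTransition.monotone.deriv_nonneg)

lemma continuous_deriv_layer (n : ℕ) : Continuous (deriv (layer n)) :=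
  (contDiff_layer n).continuous_deriv le_rfl

lemma tendsto_layer {τ : ℝ} (h : 0 < τ) : Tendsto (fun n => layer n τ) atTop (𝓝 1) := by
  refine tendsto_const_nhds.congr' ?_
  have : Tendsto (fun n : ℕ => (n : ℝ) * τ) atTop atTop :=
    tendsto_natCast_atTop_atTop.atTop_mul_const h
  filter_upwards [this.eventually_ge_atTop 2] with n hn
  exact (layer_eq_one hn).symm

lemma deriv_smoothTransition_eq_zero {σ : ℝ} (h : σ ∉ Icc (0 : ℝ) 1) :
    deriv Real.smoothTransition σ = 0 := by
  rcases lt_or_ge σ 0 with h0 | h0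
  · have : Real.smoothTransition =ᶠ[𝓝 σ] fun _ => 0 := by
      filter_upwards [Iio_mem_nhds h0] with x hx
      exact Real.smoothTransition.zero_of_nonpos (le_of_lt hx)
    rw [this.deriv_eq, deriv_const]
  · have h1 : 1 < σ := by
      by_contra hc
      exact h ⟨h0, not_lt.1 hc⟩
    have : Real.smoothTransition =ᶠ[𝓝 σ] fun _ => 1 := by
      filter_upwards [Ioi_mem_nhds h1] with x hx
      exact Real.smoothTransition.one_of_one_le (le_of_lt hx)
    rw [this.deriv_eq, deriv_const]

lemma continuous_deriv_smoothTransition : Continuous (deriv Real.smoothTransition) :=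
  (Real.smoothTransition.contDiff (n := 1)).continuous_deriv le_rfl

lemma integral_deriv_smoothTransition :
    ∫ σ : ℝ, deriv Real.smoothTransition (σ - 1) = 1 := by
  rw [integral_sub_right_eq_self (fun σ => deriv Real.smoothTransition σ)]
  have h : ∫ σ in (0 : ℝ)..1, deriv Real.smoothTransition σ = 1 := by
    rw [intervalIntegral.integral_deriv_eq_sub
      (fun x _ => (Real.smoothTransition.contDiff (n := 1)).differentiable (by simp) x)
      (continuous_deriv_smoothTransition.intervalIntegrable _ _)]
    simp [Real.smoothTransition.zero, Real.smoothTransition.one]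
  rw [← h, intervalIntegral.integral_of_le zero_le_one, ← integral_Icc_eq_integral_Ioc]
  exact (setIntegral_eq_integral_of_forall_compl_eq_zero
    fun x hx => deriv_smoothTransition_eq_zero hx).symm

/-- Integrals against the derivative of the step `layer n` of the height below the graph converge
to the integral over the hyperplane of the values on the graph. -/
theorem tendsto_integral_boundary_layer (he : ‖e‖ = 1) (hγ : Continuous γ)
    (hinv : ∀ (x : Space d) (s : ℝ), γ (x + s • e) = γ x) {g : Space d → ℝ}
    (hg : Continuous g) (hgc : HasCompactSupport g) :
    Tendsto (fun n : ℕ => ∫ x, deriv (layer n) (γ x - inner ℝ x e) * g x) atTop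
      (𝓝 (∫ y : Hyperplane e, g (graphMap e γ y))) := by
  set J : ℝ → ℝ := fun τ => ∫ y : Hyperplane e, g ((y : Space d) + (γ y - τ) • e) with hJ
  have hk : IsCompact ((Hyperplane e).orthogonalProjectionOnto '' tsupport g) :=
    hgc.isCompact.image (Hyperplane e).orthogonalProjectionOnto.continuous
  -- For every τ the integrand vanishes outside the projection of the support of `g`, a compact set
  -- independent of τ.
  have hJc : Continuous J := by
    rw [← continuousOn_univ]
    refine continuousOn_integral_of_compact_support hk (by fun_prop) ?_
    intro τ y _ hy
    by_contra hne
    exact hy ⟨_, subset_tsupport _ hne, proj_add_smul y _⟩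
  have hmp := measurePreserving_graph_prod (γ := γ) he hγ
  have step1 : ∀ n : ℕ, ∫ x, deriv (layer n) (γ x - inner ℝ x e) * g x
      = ∫ τ : ℝ, deriv (layer n) τ * J τ := by
    intro n
    have hcont : Continuous fun x => deriv (layer n) (γ x - inner ℝ x e) * g x :=
      ((continuous_deriv_layer n).comp (by fun_prop)).mul hg
    have hint : Integrable fun x => deriv (layer n) (γ x - inner ℝ x e) * g x :=
      hcont.integrable_of_hasCompactSupport hgc.mul_left
    have hval : ∀ p : Hyperplane e × ℝ,
        deriv (layer n) (γ ((p.1 : Space d) + (γ p.1 - p.2) • e)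
          - inner ℝ ((p.1 : Space d) + (γ p.1 - p.2) • e) e) = deriv (layer n) p.2 := by
      intro p
      rw [hinv, inner_add_smul he]
      congr 1
      ring
    have hint' := hmp.integrable_comp_of_integrable hint
    rw [← hmp.map_eq, integral_map hmp.measurable.aemeasurable hcont.aestronglyMeasurable]
    have hfub := integral_prod_symm (μ := (volume : Measure (Hyperplane e)))
      (ν := (volume : Measure ℝ)) _ hint'
    refine hfub.trans (integral_congr_ae (Eventually.of_forall fun τ => ?_))
    simp only [hJ, ← integral_const_mul, Function.comp]
    refine integral_congr_ae (Eventually.of_forall fun y => ?_)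
    simp only [hval (y, τ)]
  -- The substitution τ = σ/n freezes the kernel and moves the dependence on n into the argument of
  -- `J`.
  have step2 : ∀ n : ℕ, 0 < n → ∫ τ : ℝ, deriv (layer n) τ * J τ
      = ∫ σ : ℝ, deriv Real.smoothTransition (σ - 1) * J ((n : ℝ)⁻¹ * σ) := by
    intro n hn
    have hn' : (0 : ℝ) < n := Nat.cast_pos.2 hn
    have := integral_comp_mul_left
      (fun σ => deriv Real.smoothTransition (σ - 1) * J ((n : ℝ)⁻¹ * σ)) (n : ℝ)
    rw [abs_of_pos (inv_pos.2 hn'), smul_eq_mul, eq_comm, inv_mul_eq_iff_eq_mul₀ hn'.ne'] at this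
    rw [this, ← integral_const_mul]
    refine integral_congr_ae (Eventually.of_forall fun τ => ?_)
    simp only [deriv_layer, inv_mul_cancel_left₀ hn'.ne']
    ring
  -- With s = 1/n the limit is continuity at s = 0. The kernel lives on [1, 2] and has integral 1,
  -- so the value there is `J 0`.
  have hKc : Continuous fun s : ℝ =>
      ∫ σ : ℝ, deriv Real.smoothTransition (σ - 1) * J (s * σ) := by
    rw [← continuousOn_univ]
    refine continuousOn_integral_of_compact_support (isCompact_Icc (a := (1 : ℝ)) (b := 2)) ?_ ?_
    · refine Continuous.continuousOn ?_
      exact (continuous_deriv_smoothTransition.comp (by fun_prop)).mul (hJc.comp (by fun_prop))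
    · intro s σ _ hσ
      rw [deriv_smoothTransition_eq_zero, zero_mul]
      intro h
      exact hσ ⟨by linarith [h.1], by linarith [h.2]⟩
  have hlim := (hKc.tendsto 0).comp (tendsto_inv_atTop_nhds_zero_nat (𝕜 := ℝ))
  simp only [zero_mul, integral_mul_const, integral_deriv_smoothTransition, one_mul] at hlim
  have hJ0 : J 0 = ∫ y : Hyperplane e, g (graphMap e γ y) := by simp [hJ, graphMap]
  rw [← hJ0]
  refine hlim.congr' ?_
  filter_upwards [eventually_gt_atTop 0] with n hn
  rw [step1, step2 n hn]
  rfl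

end GraphCoordinates

/-! ### Local charts: height function, outward normal, finiteness of the surface measure. -/

section Charts

variable {d : ℕ} {D : Set (Space d)} {x₀ x : Space d} {r : ℝ} {e : Space d} {γ : Space d → ℝ}

namespace IsC1GraphAt

/-- The height of the graph above the point `x`. -/
def height (e : Space d) (γ : Space d → ℝ) (x : Space d) : ℝ := γ x - inner ℝ x e

lemma contDiff_height (h : IsC1GraphAt D x₀ r e γ) : ContDiff ℝ 1 (height e γ) := by
  exact h.smooth.sub (contDiff_id.inner ℝ contDiff_const)

lemma mem_iff_height (h : IsC1GraphAt D x₀ r e γ) (hx : x ∈ Metric.ball x₀ r) :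
    x ∈ D ↔ 0 < height e γ x := by
  rw [h.mem_iff x hx, height, sub_pos]

lemma hasFDerivAt_height (h : IsC1GraphAt D x₀ r e γ) (x : Space d) :
    HasFDerivAt (height e γ) (-innerSL ℝ (e - gradient γ x)) x := by
  have hγ : HasGradientAt γ (gradient γ x) x :=
    ((h.smooth.differentiable (by simp)) x).hasGradientAt
  have h1 : HasFDerivAt (fun x : Space d => inner ℝ x e) (innerSL ℝ e) x := by
    simpa [real_inner_comm] using (innerSL ℝ e).hasFDerivAt (x := x)
  refine (hγ.hasFDerivAt.sub h1).congr_fderiv ?_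
  ext v
  simp

lemma fderiv_height_apply (h : IsC1GraphAt D x₀ r e γ) (x v : Space d) :
    fderiv ℝ (height e γ) x v = -inner ℝ (e - gradient γ x) v := by
  rw [(h.hasFDerivAt_height x).fderiv]
  rfl

lemma height_sub_smul (h : IsC1GraphAt D x₀ r e γ) (x : Space d) (s : ℝ) :
    height e γ (x + s • e) = height e γ x - s := by
  rw [height, h.invariant, inner_add_left, inner_smul_left, real_inner_self_eq_norm_sq, h.norm_dir,
    height]
  simp
  ring

/-- Moving along `e` leaves γ unchanged and lowers the height at unit speed. In particular the
unnormalized normal never vanishes. -/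
lemma inner_normal_dir (h : IsC1GraphAt D x₀ r e γ) (x : Space d) :
    inner ℝ (e - gradient γ x) e = 1 := by
  have h1 : HasDerivAt (fun s : ℝ => height e γ (x + s • e))
      (-inner ℝ (e - gradient γ x) e) 0 := by
    have hl : HasDerivAt (fun s : ℝ => x + s • e) e 0 := by
      simpa using ((hasDerivAt_id (0 : ℝ)).smul_const e).const_add x
    have hf : HasFDerivAt (height e γ) (-innerSL ℝ (e - gradient γ x)) (x + (0 : ℝ) • e) := by
      simpa using h.hasFDerivAt_height x
    exact hf.comp_hasDerivAt (0 : ℝ) hl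
  have h2 : HasDerivAt (fun s : ℝ => height e γ (x + s • e)) (-1) 0 := by
    simp only [h.height_sub_smul]
    simpa using (hasDerivAt_id (0 : ℝ)).const_sub (height e γ x)
  linarith [h1.unique h2]

lemma normal_ne_zero (h : IsC1GraphAt D x₀ r e γ) (x : Space d) : e - gradient γ x ≠ 0 := by
  intro h0
  simpa [h0] using h.inner_normal_dir x

lemma height_nonneg_of_mem_closure (h : IsC1GraphAt D x₀ r e γ) (hx : x ∈ Metric.ball x₀ r)
    (hxc : x ∈ closure D) : 0 ≤ height e γ x := by
  by_contra hneg
  have hev : ∀ᶠ y in 𝓝 x, y ∈ Metric.ball x₀ r ∧ height e γ y < 0 :=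
    (Metric.isOpen_ball.eventually_mem hx).and
      (h.contDiff_height.continuous.continuousAt.eventually_lt_const (not_le.1 hneg))
  obtain ⟨y, hyD, hy⟩ := ((mem_closure_iff_frequently.1 hxc).and_eventually hev).exists
  exact absurd ((h.mem_iff_height hy.1).1 hyD) (not_lt.2 hy.2.le)

lemma mem_frontier_iff (h : IsC1GraphAt D x₀ r e γ) (hD : IsOpen D)
    (hx : x ∈ Metric.ball x₀ r) : x ∈ frontier D ↔ height e γ x = 0 := by
  rw [hD.frontier_eq]
  constructor
  · rintro ⟨hc, hnD⟩
    exact le_antisymm (not_lt.1 fun hp => hnD ((h.mem_iff_height hx).2 hp))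
      (h.height_nonneg_of_mem_closure hx hc)
  · intro h0
    refine ⟨?_, fun hxD => absurd ((h.mem_iff_height hx).1 hxD) (by simp [h0])⟩
    have hl : Tendsto (fun s : ℝ => x + (-s) • e) (𝓝[>] 0) (𝓝 x) := by
      have : Continuous fun s : ℝ => x + (-s) • e := by fun_prop
      simpa using (this.tendsto 0).mono_left nhdsWithin_le_nhds
    refine mem_closure_of_tendsto hl ?_
    filter_upwards [hl (Metric.isOpen_ball.mem_nhds hx), self_mem_nhdsWithin] with s hs hs0
    rw [h.mem_iff_height hs, h.height_sub_smul, h0]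
    simpa using hs0

/-- The definition of the normal asks for a chart centred at the boundary point itself, whereas the
finite cover supplies charts centred elsewhere. -/
lemma recenter (h : IsC1GraphAt D x₀ r e γ) (hx : x ∈ Metric.ball x₀ r) :
    IsC1GraphAt D x (r - dist x x₀) e γ where
  radius_pos := sub_pos.2 hx
  norm_dir := h.norm_dir
  smooth := h.smooth
  invariant := h.invariant
  mem_iff y hy := h.mem_iff y (Metric.ball_subset_ball' (by linarith) hy)

/-- First-order behaviour of the height along a ray from a boundary point. The factor `c` covers
both signs: `c = -1` for rays entering D, `c = 1` for rays leaving it. -/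
lemma eventually_height_pos (h : IsC1GraphAt D x₀ r e γ) (h0 : height e γ x = 0) {v : Space d}
    {c : ℝ} (hc : 0 < c * inner ℝ (e - gradient γ x) v) :
    ∀ᶠ s : ℝ in 𝓝[>] 0, c * height e γ (x + s • v) < 0 := by
  have hl : HasDerivAt (fun s : ℝ => x + s • v) v 0 := by
    simpa using ((hasDerivAt_id (0 : ℝ)).smul_const v).const_add x
  have hf : HasFDerivAt (height e γ) (-innerSL ℝ (e - gradient γ x)) (x + (0 : ℝ) • v) := by
    simpa using h.hasFDerivAt_height x
  have h1 := (hf.comp_hasDerivAt (0 : ℝ) hl).const_mul c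
  have h2 := (hasDerivAt_iff_tendsto_slope.1 h1).mono_left
    (nhdsWithin_mono 0 (fun s (hs : 0 < s) => hs.ne'))
  have h3 : c * (-innerSL ℝ (e - gradient γ x)) v < 0 := by
    change c * -inner ℝ (e - gradient γ x) v < 0
    linarith
  filter_upwards [h2.eventually_lt_const h3, self_mem_nhdsWithin] with s hs hs0
  simp only [slope_def_field, Function.comp, zero_smul, add_zero, h0, mul_zero, sub_zero] at hs
  exact neg_of_div_neg_left hs (le_of_lt hs0)

/-- Two graph representations of `D` near a boundary point have the same unit normal. -/
lemma normal_unique (h : IsC1GraphAt D x₀ r e γ) {x₁ : Space d} {r' : ℝ} {e' : Space d}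
    {γ' : Space d → ℝ} (h' : IsC1GraphAt D x₁ r' e' γ') (hD : IsOpen D) (hx : x ∈ frontier D)
    (hxb : x ∈ Metric.ball x₀ r) (hxb' : x ∈ Metric.ball x₁ r') :
    ‖e - gradient γ x‖⁻¹ • (e - gradient γ x) = ‖e' - gradient γ' x‖⁻¹ • (e' - gradient γ' x) := by
  set N := e - gradient γ x with hN
  set N' := e' - gradient γ' x with hN'
  have hNp : 0 < ‖N‖ := norm_pos_iff.2 (h.normal_ne_zero x)
  have hNp' : 0 < ‖N'‖ := norm_pos_iff.2 (h'.normal_ne_zero x)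
  have key : ∀ v, inner ℝ N v < 0 → inner ℝ N' v ≤ 0 := by
    intro v hv
    by_contra hv'
    have hl : Tendsto (fun s : ℝ => x + s • v) (𝓝[>] 0) (𝓝 x) := by
      have : Continuous fun s : ℝ => x + s • v := by fun_prop
      simpa using (this.tendsto 0).mono_left nhdsWithin_le_nhds
    have e1 := h.eventually_height_pos ((h.mem_frontier_iff hD hxb).1 hx) (v := v) (c := -1)
      (by linarith)
    have e2 := h'.eventually_height_pos ((h'.mem_frontier_iff hD hxb').1 hx) (v := v) (c := 1)
      (by linarith [not_le.1 hv'])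
    obtain ⟨s, ⟨h1, h2⟩, h3, h4⟩ := ((e1.and e2).and
      ((hl.eventually (Metric.isOpen_ball.eventually_mem hxb)).and
        (hl.eventually (Metric.isOpen_ball.eventually_mem hxb')))).exists
    have hsD := (h.mem_iff_height h3).2 (by linarith)
    linarith [(h'.mem_iff_height h4).1 hsD]
  -- If the unit normals n and n' differ, the direction n' - n enters D according to one chart and
  -- leaves it according to the other, which contradicts `key`.
  by_contra hne
  have hu : ‖‖N‖⁻¹ • N‖ = 1 := norm_smul_inv_norm (𝕜 := ℝ) (norm_pos_iff.1 hNp)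
  have hu' : ‖‖N'‖⁻¹ • N'‖ = 1 := norm_smul_inv_norm (𝕜 := ℝ) (norm_pos_iff.1 hNp')
  have hlt := (inner_lt_one_iff_real_of_norm_eq_one hu hu').2 hne
  set n := ‖N‖⁻¹ • N
  set n' := ‖N'‖⁻¹ • N'
  have i1 : inner ℝ n (n' - n) < 0 := by
    rw [inner_sub_right, real_inner_self_eq_norm_sq, hu]; linarith
  have i2 : 0 < inner ℝ n' (n' - n) := by
    rw [inner_sub_right, real_inner_self_eq_norm_sq, hu', real_inner_comm]; linarith
  have hle := key (n' - n) (by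
    rw [real_inner_smul_left] at i1
    exact neg_of_mul_neg_right i1 (by positivity))
  rw [real_inner_smul_left] at i2
  exact absurd hle (not_le.2 (pos_of_mul_pos_right i2 (by positivity)))

lemma outwardNormal_eq (h : IsC1GraphAt D x₀ r e γ) (hD : IsOpen D) (hx : x ∈ frontier D)
    (hxb : x ∈ Metric.ball x₀ r) :
    outwardNormal D x = ‖e - gradient γ x‖⁻¹ • (e - gradient γ x) := by
  have hex : ∃ ν, IsOutwardUnitNormal D x ν := ⟨_, hx, _, e, γ, h.recenter hxb, rfl⟩
  rw [outwardNormal, dif_pos hex]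
  obtain ⟨-, r', e', γ', h', hν⟩ := hex.choose_spec
  rw [hν]
  exact h'.normal_unique h hD hx (Metric.mem_ball_self h'.radius_pos) hxb

lemma fderiv_height_eq_inner_outwardNormal (h : IsC1GraphAt D x₀ r e γ) (hD : IsOpen D)
    (hx : x ∈ frontier D) (hxb : x ∈ Metric.ball x₀ r) (v : Space d) :
    fderiv ℝ (height e γ) x v = -(‖e - gradient γ x‖ * inner ℝ v (outwardNormal D x)) := by
  have : ‖e - gradient γ x‖ ≠ 0 := norm_ne_zero_iff.2 (h.normal_ne_zero x)
  rw [h.fderiv_height_apply, h.outwardNormal_eq hD hx hxb, real_inner_smul_right,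
    mul_inv_cancel_left₀ this, real_inner_comm]

lemma continuous_normal (h : IsC1GraphAt D x₀ r e γ) : Continuous fun x => e - gradient γ x := by
  have := h.smooth.continuous_fderiv (by simp)
  unfold gradient
  fun_prop

end IsC1GraphAt

lemma continuousOn_outwardNormal (hD : IsOpen D) (hC : HasC1Boundary D) :
    ContinuousOn (outwardNormal D) (frontier D) := by
  intro x hx
  obtain ⟨r, e, γ, h⟩ := hC x hx
  have hev : outwardNormal D =ᶠ[𝓝[frontier D] x]
      fun x => ‖e - gradient γ x‖⁻¹ • (e - gradient γ x) := by
    filter_upwards [self_mem_nhdsWithin,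
      mem_nhdsWithin_of_mem_nhds (Metric.ball_mem_nhds x h.radius_pos)] with y hy hyb
    exact h.outwardNormal_eq hD hy hyb
  have hc : Continuous fun x => ‖e - gradient γ x‖⁻¹ • (e - gradient γ x) :=
    (h.continuous_normal.norm.inv₀ fun x => norm_ne_zero_iff.2 (h.normal_ne_zero x)).smul
      h.continuous_normal
  exact hc.continuousWithinAt.congr_of_eventuallyEq hev (hev.eq_of_nhdsWithin hx)

lemma isCompact_frontier (hb : Bornology.IsBounded D) : IsCompact (frontier D) :=
  hb.isCompact_closure.of_isClosed_subset isClosed_frontier frontier_subset_closure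

/-- By compactness it suffices to argue locally, where ∂D lies in a Lipschitz image of a bounded
piece of the hyperplane, on which the Hausdorff measure is Lebesgue measure. -/
lemma surfaceMeasure_univ_lt_top (hD : IsOpen D) (hb : Bornology.IsBounded D)
    (hC : HasC1Boundary D) : surfaceMeasure D univ < ⊤ := by
  rw [surfaceMeasure, Measure.restrict_apply_univ]
  refine (isCompact_frontier hb).measure_lt_top_of_nhdsWithin fun x hx => ?_
  obtain ⟨r, e, γ, h⟩ := hC x hx
  set P := (Hyperplane e).orthogonalProjectionOnto with hP
  have hsm : ContDiffAt ℝ 1 (graphMap e γ) (P x) := by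
    have hs : ContDiff ℝ 1 fun y : Hyperplane e => (y : Space d) :=
      (Hyperplane e).subtypeL.contDiff
    exact (hs.add ((h.smooth.comp hs).smul contDiff_const)).contDiffAt
  obtain ⟨L, t, ht, hL⟩ := hsm.exists_lipschitzOnWith
  set B := t ∩ Metric.closedBall (P x) 1 with hB
  have hBn : B ∈ 𝓝 (P x) := inter_mem ht (Metric.closedBall_mem_nhds _ one_pos)
  have hBfin : μHE[d - 1] B < ⊤ := by
    rw [← finrank_hyperplane h.norm_dir, InnerProductSpace.euclideanHausdorffMeasure_eq_volume]
    exact (measure_mono inter_subset_right).trans_lt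
      (isCompact_closedBall (P x) 1).measure_lt_top
  refine ⟨graphMap e γ '' B, ?_, ?_⟩
  · filter_upwards [self_mem_nhdsWithin,
      mem_nhdsWithin_of_mem_nhds (Metric.ball_mem_nhds x h.radius_pos),
      mem_nhdsWithin_of_mem_nhds (P.continuous.continuousAt hBn)] with y hy hyb hyB
    refine ⟨P y, hyB, ?_⟩
    have hy0 := (h.mem_frontier_iff hD hyb).1 hy
    have hdec := proj_add_inner_smul h.norm_dir y
    have hγ : γ (P y : Space d) = γ y := by
      conv_rhs => rw [← hdec, h.invariant]
    rw [graphMap, hγ, sub_eq_zero.1 hy0, hdec]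
  · refine lt_of_le_of_lt ?_ (ENNReal.mul_lt_top
      (ENNReal.rpow_lt_top_of_nonneg (y := ((d - 1 : ℕ) : ℝ)) (by positivity)
        (ENNReal.coe_ne_top (r := L))) hBfin)
    simp only [euclideanHausdorffMeasure_def, Measure.smul_apply]
    have := (hL.mono inter_subset_left : LipschitzOnWith L (graphMap e γ) B).hausdorffMeasure_image_le
      (d := ((d - 1 : ℕ) : ℝ)) (by positivity)
    rw [mul_smul_comm]
    gcongr

end Charts

/-! ### Flux through the boundary layer of a single chart. -/

section Cutoff

variable {d : ℕ} {D : Set (Space d)} {x₀ x : Space d} {r : ℝ} {e : Space d} {γ : Space d → ℝ}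

namespace IsC1GraphAt

lemma hasFDerivAt_layer_height (h : IsC1GraphAt D x₀ r e γ) (n : ℕ) (x : Space d) :
    HasFDerivAt (fun x => layer n (height e γ x))
      (deriv (layer n) (height e γ x) • fderiv ℝ (height e γ) x) x :=
  ((contDiff_layer n).differentiable (by simp) _).hasDerivAt.comp_hasFDerivAt x
    (h.contDiff_height.differentiable (by simp) x).hasFDerivAt

lemma contDiff_layer_height (h : IsC1GraphAt D x₀ r e γ) (n : ℕ) :
    ContDiff ℝ 1 fun x => layer n (height e γ x) :=
  (contDiff_layer n).comp h.contDiff_height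

lemma fderiv_mul_one_sub_layer (h : IsC1GraphAt D x₀ r e γ) {ψ : Space d → ℝ}
    (hψ : ContDiff ℝ 1 ψ) (n : ℕ) (x v : Space d) :
    fderiv ℝ (fun x => ψ x * (1 - layer n (height e γ x))) x v =
      (1 - layer n (height e γ x)) * fderiv ℝ ψ x v -
        deriv (layer n) (height e γ x) * (ψ x * fderiv ℝ (height e γ) x v) := by
  have h1 : HasFDerivAt (fun x => ψ x * (1 - layer n (height e γ x))) _ x :=
    (hψ.differentiable (by simp) x).hasFDerivAt.mul
      ((h.hasFDerivAt_layer_height n x).const_sub 1)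
  rw [h1.fderiv]
  simp
  ring

end IsC1GraphAt

lemma deriv_layer_eq_zero_of_nonpos {n : ℕ} {τ : ℝ} (h : τ ≤ 0) : deriv (layer n) τ = 0 := by
  rw [deriv_layer, deriv_smoothTransition_eq_zero, mul_zero]
  intro hc
  nlinarith [(Nat.cast_nonneg n : (0 : ℝ) ≤ n), hc.1]

/-- On ∂D the differential of the height is -‖e - ∇γ‖ times the normal component, which yields the
factor `L`. Points of the graph off ∂D lie outside the ball, where ψ vanishes; on the rest the
pushed-forward measure is at most surface measure. -/
lemma abs_integral_graph_le (hD : IsOpen D) (hb : Bornology.IsBounded D) (hC : HasC1Boundary D)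
    (h : IsC1GraphAt D x₀ r e γ) {ψ : Space d → ℝ} (hψ : Continuous ψ)
    (hψc : HasCompactSupport ψ) (hψs : tsupport ψ ⊆ Metric.ball x₀ r) {L : ℝ}
    (hL : ∀ x, ‖ψ x * ‖e - gradient γ x‖‖ ≤ L) {w : Space d → Space d} (hw : Continuous w) :
    |∫ y, ψ (graphMap e γ y) * fderiv ℝ (IsC1GraphAt.height e γ) (graphMap e γ y)
        (w (graphMap e γ y))| ≤
      L * ∫ x, |inner ℝ (w x) (outwardNormal D x)| ∂(surfaceMeasure D) := by
  have : IsFiniteMeasure (surfaceMeasure D) := ⟨surfaceMeasure_univ_lt_top hD hb hC⟩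
  set k : Space d → ℝ := fun x => |ψ x * fderiv ℝ (IsC1GraphAt.height e γ) x (w x)| with hk
  have hkc : Continuous k :=
    (hψ.mul ((h.contDiff_height.continuous_fderiv (by simp)).clm_apply hw)).abs
  have hkcs : HasCompactSupport k :=
    hψc.mono fun x hx hx0 => hx (by simp [hk, hx0])
  have hγc := h.smooth.continuous
  have hΦ : Continuous (graphMap e γ) := by unfold graphMap; fun_prop
  set ν := (volume : Measure (Hyperplane e)).map (graphMap e γ) with hν
  have hsupp : ∀ y, graphMap e γ y ∉ frontier D → k (graphMap e γ y) = 0 := by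
    intro y hy
    have hnb : graphMap e γ y ∉ Metric.ball x₀ r := by
      intro hbll
      refine hy ((h.mem_frontier_iff hD hbll).2 ?_)
      rw [graphMap, h.height_sub_smul, IsC1GraphAt.height, inner_coe_hyperplane]
      ring
    have : ψ (graphMap e γ y) = 0 := image_eq_zero_of_notMem_tsupport fun hc => hnb (hψs hc)
    simp [hk, this]
  calc |∫ y, ψ (graphMap e γ y) * fderiv ℝ (IsC1GraphAt.height e γ) (graphMap e γ y)
        (w (graphMap e γ y))|
      ≤ ∫ y, k (graphMap e γ y) := abs_integral_le_integral_abs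
    _ = ∫ x, k x ∂ν := (integral_map hΦ.measurable.aemeasurable
          hkc.aestronglyMeasurable).symm
    _ = ∫ x in frontier D, k x ∂ν := by
        refine (setIntegral_eq_integral_of_ae_compl_eq_zero ?_).symm
        rw [hν, ae_map_iff hΦ.measurable.aemeasurable]
        · exact Eventually.of_forall hsupp
        · exact (isClosed_frontier.measurableSet.compl.imp
            (hkc.measurable (measurableSet_singleton (0 : ℝ))))
    _ ≤ ∫ x, k x ∂(surfaceMeasure D) := by
        refine integral_mono_measure
          (Measure.restrict_mono le_rfl (map_graphMap_le h.norm_dir hγc))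
          (Eventually.of_forall fun x => abs_nonneg _) ?_
        exact hkc.integrable_of_hasCompactSupport hkcs
    _ ≤ ∫ x, L * |inner ℝ (w x) (outwardNormal D x)| ∂(surfaceMeasure D) := by
        refine setIntegral_mono_on (f := k) (s := frontier D) (μ := μHE[d - 1])
          (hkc.integrable_of_hasCompactSupport hkcs (μ := surfaceMeasure D)) ?_
          isClosed_frontier.measurableSet ?_
        · refine ContinuousOn.integrableOn_of_subset_isCompact (K := frontier D)
            ?_ (isCompact_frontier hb) isClosed_frontier.measurableSet subset_rfl ?_
          · exact continuousOn_const.mul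
              (hw.continuousOn.inner (continuousOn_outwardNormal hD hC)).abs
          · simpa [surfaceMeasure] using (measure_lt_top (surfaceMeasure D) univ).ne
        · intro x hx
          by_cases hxb : x ∈ Metric.ball x₀ r
          · simp only [hk]
            rw [h.fderiv_height_eq_inner_outwardNormal hD hx hxb, mul_neg, abs_neg, ← mul_assoc,
              abs_mul]
            gcongr
            exact hL x
          · have : ψ x = 0 := image_eq_zero_of_notMem_tsupport fun hc => hxb (hψs hc)
            simp only [hk, this, zero_mul, abs_zero]
            exact mul_nonneg ((norm_nonneg _).trans (hL x)) (abs_nonneg _)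
    _ = _ := integral_const_mul _ _

/-- The flux through the boundary layer of one chart: it is bounded uniformly, and in the limit it
is bounded by the normal component on the boundary. -/
lemma chart_flux (hD : IsOpen D) (hb : Bornology.IsBounded D) (hC : HasC1Boundary D)
    (h : IsC1GraphAt D x₀ r e γ) {ψ : Space d → ℝ} (hψ : ContDiff ℝ 1 ψ)
    (hψc : HasCompactSupport ψ) (hψs : tsupport ψ ⊆ Metric.ball x₀ r) (hψ0 : ∀ x, 0 ≤ ψ x) :
    ∃ K, 0 ≤ K ∧ ∀ w : Space d → Space d, Continuous w →
      (∀ M, 0 ≤ M → (∀ x ∈ D, ‖w x‖ ≤ M) → ∀ n, |∫ x in D,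
        fderiv ℝ (fun x => ψ x * (1 - layer n (IsC1GraphAt.height e γ x))) x (w x)| ≤ K * M) ∧
      ∃ b, Tendsto (fun n => ∫ x in D,
          fderiv ℝ (fun x => ψ x * (1 - layer n (IsC1GraphAt.height e γ x))) x (w x))
          atTop (𝓝 b) ∧
        |b| ≤ K * ∫ x, |inner ℝ (w x) (outwardNormal D x)| ∂(surfaceMeasure D) := by
  set F := IsC1GraphAt.height e γ with hF
  have hFc : Continuous F := h.contDiff_height.continuous
  have hF' : Continuous (fderiv ℝ F) := h.contDiff_height.continuous_fderiv (by simp)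
  have hψ' : Continuous (fderiv ℝ ψ) := hψ.continuous_fderiv (by simp)
  have hψc' : HasCompactSupport (fderiv ℝ ψ) := hψc.fderiv ℝ
  have hlc : ∀ n, Continuous fun x => deriv (layer n) (F x) := fun n =>
    (continuous_deriv_layer n).comp hFc
  set g₁ : Space d → ℝ := fun x => ψ x * ‖fderiv ℝ F x‖ with hg₁
  have hg₁c : Continuous g₁ := hψ.continuous.mul hF'.norm
  have hg₁s : HasCompactSupport g₁ := hψc.mul_right
  -- A convergent sequence is bounded: `B` controls the mass of the layer gradient for all n at
  -- once.
  obtain ⟨B, hB⟩ := (tendsto_integral_boundary_layer h.norm_dir h.smooth.continuous h.invariant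
    hg₁c hg₁s).bddAbove_range
  have hB' : ∀ n, ∫ x, deriv (layer n) (F x) * g₁ x ≤ B := fun n => hB ⟨n, rfl⟩
  have hB0 : 0 ≤ B := (integral_nonneg fun x => mul_nonneg (deriv_layer_nonneg 0 _)
    (mul_nonneg (hψ0 x) (norm_nonneg _))).trans (hB' 0)
  set A := ∫ x, ‖fderiv ℝ ψ x‖ with hA
  have hA0 : 0 ≤ A := integral_nonneg fun x => norm_nonneg _
  have hAi : Integrable fun x => ‖fderiv ℝ ψ x‖ :=
    hψ'.norm.integrable_of_hasCompactSupport hψc'.norm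
  have hBi : ∀ n, Integrable fun x => deriv (layer n) (F x) * g₁ x := fun n =>
    ((hlc n).mul hg₁c).integrable_of_hasCompactSupport hg₁s.mul_left
  obtain ⟨L, hL⟩ := (hψc.mul_right (f' := fun x => ‖e - gradient γ x‖)).exists_bound_of_continuous
    (hψ.continuous.mul h.continuous_normal.norm)
  have hL0 : 0 ≤ L := (norm_nonneg _).trans (hL 0)
  -- `A` (gradient of ψ) and `B` (gradient of the step) serve the uniform bound; `L` serves the
  -- limit.
  refine ⟨A + B + L, by positivity, fun w hw => ⟨fun M hM hwM n => ?_, ?_⟩⟩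
  · have hi : Integrable fun x => M * (‖fderiv ℝ ψ x‖ + deriv (layer n) (F x) * g₁ x) :=
      (hAi.add (hBi n)).const_mul M
    have hbd : ‖∫ x in D, fderiv ℝ (fun x => ψ x * (1 - layer n (F x))) x (w x)‖ ≤
        ∫ x in D, M * (‖fderiv ℝ ψ x‖ + deriv (layer n) (F x) * g₁ x) := by
      refine norm_integral_le_of_norm_le hi.integrableOn ?_
      filter_upwards [ae_restrict_mem hD.measurableSet] with x hx
      rw [h.fderiv_mul_one_sub_layer hψ]
      have hv := hwM x hx
      have e1 : |(1 - layer n (F x)) * fderiv ℝ ψ x (w x)| ≤ M * ‖fderiv ℝ ψ x‖ := by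
        rw [abs_mul]
        have h1 : |1 - layer n (F x)| ≤ 1 := by
          rw [abs_le]
          constructor <;> linarith [layer_nonneg n (F x), layer_le_one n (F x)]
        have h2 : |fderiv ℝ ψ x (w x)| ≤ ‖fderiv ℝ ψ x‖ * M :=
          (fderiv ℝ ψ x).le_opNorm_of_le hv
        calc _ ≤ 1 * (‖fderiv ℝ ψ x‖ * M) := by gcongr
          _ = _ := by ring
      have e2 : |deriv (layer n) (F x) * (ψ x * fderiv ℝ F x (w x))| ≤
          M * (deriv (layer n) (F x) * g₁ x) := by
        rw [abs_mul, abs_mul, abs_of_nonneg (deriv_layer_nonneg n _), abs_of_nonneg (hψ0 x)]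
        have h2 : |fderiv ℝ F x (w x)| ≤ ‖fderiv ℝ F x‖ * M :=
          (fderiv ℝ F x).le_opNorm_of_le hv
        calc _ ≤ deriv (layer n) (F x) * (ψ x * (‖fderiv ℝ F x‖ * M)) := by
              gcongr
              · exact deriv_layer_nonneg n _
              · exact hψ0 x
          _ = _ := by simp only [hg₁]; ring
      refine (norm_sub_le _ _).trans ?_
      rw [Real.norm_eq_abs, Real.norm_eq_abs, mul_add]
      exact add_le_add e1 e2
    rw [Real.norm_eq_abs] at hbd
    refine hbd.trans ((setIntegral_le_integral hi (Eventually.of_forall fun x => ?_)).trans ?_)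
    · exact mul_nonneg hM (add_nonneg (norm_nonneg _) (mul_nonneg (deriv_layer_nonneg n _)
        (mul_nonneg (hψ0 x) (norm_nonneg _))))
    · rw [integral_const_mul, integral_add hAi (hBi n)]
      nlinarith [hB' n]
  · set g : Space d → ℝ := fun x => ψ x * fderiv ℝ F x (w x) with hg
    have hgc : Continuous g := hψ.continuous.mul (hF'.clm_apply hw)
    have hgs : HasCompactSupport g := hψc.mul_right
    refine ⟨-∫ y, g (graphMap e γ y), ?_, ?_⟩
    · have hp : Continuous fun x => fderiv ℝ ψ x (w x) := hψ'.clm_apply hw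
      have hps : HasCompactSupport fun x => fderiv ℝ ψ x (w x) :=
        hψc'.mono fun x hx hx0 => hx (by simp [hx0])
      have hpc : ∀ n, Continuous fun x => (1 - layer n (F x)) * fderiv ℝ ψ x (w x) := fun n =>
        (continuous_const.sub ((contDiff_layer n).continuous.comp hFc)).mul hp
      -- In D the step tends to 1 on the support of ψ, so the term carrying the gradient of ψ
      -- disappears and only the layer term survives.
      have t1 : Tendsto (fun n => ∫ x in D, (1 - layer n (F x)) * fderiv ℝ ψ x (w x)) atTop
          (𝓝 (∫ x in D, (0 : ℝ))) := by
        refine tendsto_integral_of_dominated_convergence (fun x => ‖fderiv ℝ ψ x (w x)‖)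
          (fun n => (hpc n).aestronglyMeasurable)
          (hp.norm.integrable_of_hasCompactSupport hps.norm).integrableOn (fun n => ?_) ?_
        · refine Eventually.of_forall fun x => ?_
          rw [norm_mul]
          refine mul_le_of_le_one_left (norm_nonneg _) ?_
          rw [Real.norm_eq_abs, abs_le]
          constructor <;> linarith [layer_nonneg n (F x), layer_le_one n (F x)]
        · filter_upwards [ae_restrict_mem hD.measurableSet] with x hx
          by_cases hxb : x ∈ Metric.ball x₀ r
          · have := ((tendsto_layer ((h.mem_iff_height hxb).1 hx)).const_sub 1).mul_const
              (fderiv ℝ ψ x (w x))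
            simpa using this
          · have : fderiv ℝ ψ x = 0 := by
              refine image_eq_zero_of_notMem_tsupport fun hc => hxb (hψs ?_)
              exact tsupport_fderiv_subset ℝ hc
            simp [this]
      have t2 := tendsto_integral_boundary_layer h.norm_dir h.smooth.continuous h.invariant hgc hgs
      have t3 := t1.sub t2
      simp only [integral_zero, zero_sub] at t3
      refine t3.congr fun n => ?_
      -- The step is constant at nonpositive heights, so the layer lies on the D side of the graph
      -- and restricting to D loses nothing.
      have hz : ∫ x, deriv (layer n) (γ x - inner ℝ x e) * g x
          = ∫ x in D, deriv (layer n) (F x) * g x := by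
        refine (setIntegral_eq_integral_of_forall_compl_eq_zero fun x hx => ?_).symm
        by_cases hxb : x ∈ Metric.ball x₀ r
        · have h0 : γ x - inner ℝ x e ≤ 0 := not_lt.1 fun hp => hx ((h.mem_iff_height hxb).2 hp)
          rw [deriv_layer_eq_zero_of_nonpos h0, zero_mul]
        · have : ψ x = 0 := image_eq_zero_of_notMem_tsupport fun hc => hxb (hψs hc)
          simp [hg, this]
      rw [hz, ← integral_sub]
      · refine integral_congr_ae (Eventually.of_forall fun x => ?_)
        exact (h.fderiv_mul_one_sub_layer hψ n x (w x)).symm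
      · exact ((hpc n).integrable_of_hasCompactSupport hps.mul_left).integrableOn
      · exact (((hlc n).mul hgc).integrable_of_hasCompactSupport hgs.mul_left).integrableOn
    · rw [abs_neg]
      refine (abs_integral_graph_le hD hb hC h hψ.continuous hψc hψs hL hw).trans ?_
      gcongr
      linarith

end Cutoff

/-! ### Global cutoff sequences from a partition of unity. -/

section Exhaustion

open scoped Manifold ContDiff

variable {d : ℕ} {D : Set (Space d)}

lemma exists_continuous_extension {w : Space d → Space d} (hw : ContinuousOn w (closure D)) :
    ∃ W : Space d → Space d, Continuous W ∧ EqOn W w (closure D) := by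
  obtain ⟨G, hG⟩ := ContinuousMap.exists_restrict_eq (isClosed_closure (s := D))
    ⟨(closure D).domRestrict w, hw.domRestrict⟩
  refine ⟨G, G.continuous, fun x hx => ?_⟩
  exact congrArg (fun f : C(closure D, Space d) => f ⟨x, hx⟩) hG

/-- A finite family of `C^1` graph charts, with a partition of unity on `closure D` whose member
`none` is supported in `D` and whose other members are supported in the charts. -/
lemma exists_charts_partition (hD : IsOpen D) (hb : Bornology.IsBounded D)
    (hC : HasC1Boundary D) :
    ∃ (ι : Type) (_ : Fintype ι) (x₀ : ι → Space d) (r : ι → ℝ) (e : ι → Space d)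
      (γ : ι → Space d → ℝ) (ψ : Option ι → Space d → ℝ),
      (∀ i, IsC1GraphAt D (x₀ i) (r i) (e i) (γ i)) ∧ (∀ i, ContDiff ℝ 1 (ψ i)) ∧
      (∀ i x, 0 ≤ ψ i x) ∧ (∀ x ∈ closure D, ∑ i, ψ i x = 1) ∧ (∀ x, ∑ i, ψ i x ≤ 1) ∧
      tsupport (ψ none) ⊆ D ∧ ∀ i, tsupport (ψ (some i)) ⊆ Metric.ball (x₀ i) (r i) := by
  have hC' : ∀ x : frontier D, ∃ (r : ℝ) (e : Space d) (γ : Space d → ℝ),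
      IsC1GraphAt D x r e γ := fun x => hC x x.2
  choose r e γ h using hC'
  obtain ⟨t, ht⟩ := (isCompact_frontier hb).elim_finite_subcover
    (fun x : frontier D => Metric.ball (x : Space d) (r x)) (fun x => Metric.isOpen_ball)
    (fun x hx => mem_iUnion.2 ⟨⟨x, hx⟩, Metric.mem_ball_self (h ⟨x, hx⟩).radius_pos⟩)
  let c : Fin t.card → frontier D := fun i => (t.equivFin.symm i : frontier D)
  let U : Option (Fin t.card) → Set (Space d) := fun i =>
    i.elim D fun j => Metric.ball (c j : Space d) (r (c j))
  have hUo : ∀ i, IsOpen (U i) := by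
    rintro (_ | j)
    exacts [hD, Metric.isOpen_ball]
  have hUc : closure D ⊆ ⋃ i, U i := by
    intro x hx
    by_cases hxD : x ∈ D
    · exact mem_iUnion.2 ⟨none, hxD⟩
    · have hxf : x ∈ frontier D := by
        rw [hD.frontier_eq]
        exact ⟨hx, hxD⟩
      obtain ⟨y, hyt, hy⟩ := mem_iUnion₂.1 (ht hxf)
      refine mem_iUnion.2 ⟨some (t.equivFin ⟨y, hyt⟩), ?_⟩
      simpa [U, c] using hy
  obtain ⟨f, hf⟩ := SmoothPartitionOfUnity.exists_isSubordinate 𝓘(ℝ, Space d)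
    (isClosed_closure (s := D)) U hUo hUc
  refine ⟨Fin t.card, inferInstance, fun i => c i, fun i => r (c i), fun i => e (c i),
    fun i => γ (c i), fun i => f i, fun i => h _, fun i => ?_, fun i x => f.nonneg i x,
    fun x hx => ?_, fun x => ?_, hf none, fun i => hf (some i)⟩
  · exact ((f i).contMDiff.contDiff).of_le (by exact_mod_cast le_top)
  · rw [← finsum_eq_sum_of_fintype]
    exact f.sum_eq_one hx
  · rw [← finsum_eq_sum_of_fintype]
    exact f.sum_le_one x

/-- A sequence of `C^1` cutoff functions that exhausts `D`, and whose gradients represent the flux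
through the boundary in the limit, up to the constant `K`. -/
structure IsCutoffSequence (D : Set (Space d)) (φ : ℕ → Space d → ℝ) (K : ℝ) : Prop where
  const_nonneg : 0 ≤ K
  contDiff : ∀ n, ContDiff ℝ 1 (φ n)
  hasCompactSupport : ∀ n, HasCompactSupport (φ n)
  tsupport_subset : ∀ n, tsupport (φ n) ⊆ D
  nonneg : ∀ n x, 0 ≤ φ n x
  le_one : ∀ n x, φ n x ≤ 1
  tendsto_one : ∀ x ∈ D, Tendsto (fun n => φ n x) atTop (𝓝 1)
  abs_integral_le : ∀ w : Space d → Space d, ContinuousOn w (closure D) → ∀ M, 0 ≤ M →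
    (∀ x ∈ D, ‖w x‖ ≤ M) → ∀ n, |∫ x in D, fderiv ℝ (φ n) x (w x)| ≤ K * M
  exists_flux : ∀ w : Space d → Space d, ContinuousOn w (closure D) →
    ∃ b, Tendsto (fun n => ∫ x in D, fderiv ℝ (φ n) x (w x)) atTop (𝓝 b) ∧
      |b| ≤ K * ∫ x, |inner ℝ (w x) (outwardNormal D x)| ∂(surfaceMeasure D)

/-- Each boundary member ψ_i of the partition is multiplied by the step of its own height. On D the
result equals 1 - Σ ψ_i (1 - step), so its gradient is minus the sum of the gradients treated by
`chart_flux`, and the chart constants add up. Fields continuous on the closure are first extended by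
Tietze's theorem. -/
theorem exists_isCutoffSequence (hD : IsOpen D) (hb : Bornology.IsBounded D)
    (hC : HasC1Boundary D) : ∃ φ K, IsCutoffSequence D φ K := by
  obtain ⟨ι, _, x₀, r, e, γ, ψ, h, hψ, hψ0, hψ1, hψle, hs0, hs⟩ :=
    exists_charts_partition hD hb hC
  let F : ι → Space d → ℝ := fun i => IsC1GraphAt.height (e i) (γ i)
  have hψc : ∀ i, HasCompactSupport (ψ (some i)) := fun i =>
    Metric.isCompact_of_isClosed_isBounded (isClosed_tsupport _)
      (Metric.isBounded_ball.subset (hs i))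
  choose K hK0 hK using fun i =>
    chart_flux hD hb hC (h i) (hψ (some i)) (hψc i) (hs i) (hψ0 (some i))
  let φ : ℕ → Space d → ℝ := fun n x =>
    ψ none x + ∑ i, ψ (some i) x * layer n (F i x)
  have hφsupp : ∀ n, tsupport (φ n) ⊆ D := by
    intro n
    -- The step is zero unless n times the height exceeds 1. The closed condition 1 ≤ n·height
    -- survives taking closures and still forces positive height.
    have hcl : IsClosed (tsupport (ψ none) ∪
        ⋃ i, (tsupport (ψ (some i)) ∩ {x | 1 ≤ n * F i x})) := by
      refine (isClosed_tsupport _).union (isClosed_iUnion_of_finite fun i =>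
        (isClosed_tsupport _).inter (isClosed_le continuous_const ?_))
      exact continuous_const.mul (h i).contDiff_height.continuous
    refine (closure_minimal ?_ hcl).trans ?_
    · intro x hx
      by_contra hc
      simp only [mem_union, mem_iUnion, mem_inter_iff, mem_ofPred_eq, not_or, not_exists,
        not_and, not_le] at hc
      refine hx ?_
      simp only [φ, image_eq_zero_of_notMem_tsupport hc.1, zero_add]
      refine Finset.sum_eq_zero fun i _ => ?_
      by_cases hxi : x ∈ tsupport (ψ (some i))
      · rw [layer_eq_zero (hc.2 i hxi).le, mul_zero]
      · rw [image_eq_zero_of_notMem_tsupport hxi, zero_mul]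
    · refine union_subset hs0 (iUnion_subset fun i x hx => ?_)
      refine ((h i).mem_iff_height (hs i hx.1)).2 ?_
      by_contra hneg
      have h1 : (1 : ℝ) ≤ n * F i x := hx.2
      have h2 : F i x ≤ 0 := not_lt.1 hneg
      nlinarith [(Nat.cast_nonneg n : (0 : ℝ) ≤ n)]
  have hφd : ∀ n, ContDiff ℝ 1 (φ n) := fun n =>
    (hψ none).add (ContDiff.sum fun i _ => (hψ (some i)).mul ((h i).contDiff_layer_height n))
  have hφeq : ∀ n, ∀ x ∈ D, φ n x = 1 - ∑ i, ψ (some i) x * (1 - layer n (F i x)) := by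
    intro n x hx
    have := hψ1 x (subset_closure hx)
    rw [Fintype.sum_option] at this
    simp only [φ, mul_sub, mul_one, Finset.sum_sub_distrib]
    linarith
  have hθ : ∀ n i, ContDiff ℝ 1 fun x => ψ (some i) x * (1 - layer n (F i x)) := fun n i =>
    (hψ (some i)).mul (contDiff_const.sub ((h i).contDiff_layer_height n))
  have hgrad : ∀ n, ∀ x ∈ D, ∀ v, fderiv ℝ (φ n) x v =
      -∑ i, fderiv ℝ (fun x => ψ (some i) x * (1 - layer n (F i x))) x v := by
    intro n x hx v
    have hev : φ n =ᶠ[𝓝 x] fun x => 1 - ∑ i, ψ (some i) x * (1 - layer n (F i x)) := by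
      filter_upwards [hD.mem_nhds hx] with y hy using hφeq n y hy
    have hd : HasFDerivAt (fun x => 1 - ∑ i, ψ (some i) x * (1 - layer n (F i x)))
        (-∑ i, fderiv ℝ (fun x => ψ (some i) x * (1 - layer n (F i x))) x) x :=
      (HasFDerivAt.fun_sum fun i _ =>
        ((hθ n i).differentiable (by simp) x).hasFDerivAt).const_sub 1
    rw [hev.fderiv_eq, hd.fderiv]
    simp
  have hint : ∀ w W : Space d → Space d, Continuous W → EqOn W w (closure D) → ∀ n,
      ∫ x in D, fderiv ℝ (φ n) x (w x) = -∑ i, ∫ x in D,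
        fderiv ℝ (fun x => ψ (some i) x * (1 - layer n (F i x))) x (W x) := by
    intro w W hW hWw n
    rw [← integral_finsetSum, ← integral_neg]
    · refine setIntegral_congr_fun hD.measurableSet fun x hx => ?_
      rw [← hWw (subset_closure hx)]
      exact hgrad n x hx _
    · intro i _
      refine Integrable.integrableOn (Continuous.integrable_of_hasCompactSupport ?_ ?_)
      · exact ((hθ n i).continuous_fderiv (by simp)).clm_apply hW
      · refine ((hψc i).mul_right.fderiv ℝ).mono
          (f := fderiv ℝ fun x => ψ (some i) x * (1 - layer n (F i x)))
          fun x hx hx0 => hx ?_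
        simp only [hx0, zero_apply]
  refine ⟨φ, ∑ i, K i, Finset.sum_nonneg fun i _ => hK0 i, hφd, fun n => ?_, hφsupp, ?_, ?_, ?_,
    ?_, ?_⟩
  · exact Metric.isCompact_of_isClosed_isBounded (isClosed_tsupport _) (hb.subset (hφsupp n))
  · exact fun n x => add_nonneg (hψ0 _ _) (Finset.sum_nonneg fun i _ =>
      mul_nonneg (hψ0 _ _) (layer_nonneg _ _))
  · intro n x
    refine le_trans ?_ (hψle x)
    rw [Fintype.sum_option]
    refine add_le_add le_rfl (Finset.sum_le_sum fun i _ => ?_)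
    exact mul_le_of_le_one_right (hψ0 _ _) (layer_le_one _ _)
  · intro x hx
    have hlim : Tendsto (fun n => 1 - ∑ i, ψ (some i) x * (1 - layer n (F i x))) atTop
        (𝓝 (1 - ∑ i : ι, 0)) := by
      refine (tendsto_finsetSum _ fun i _ => ?_).const_sub 1
      by_cases hxi : x ∈ Metric.ball (x₀ i) (r i)
      · simpa using ((tendsto_layer (((h i).mem_iff_height hxi).1 hx)).const_sub 1).const_mul
          (ψ (some i) x)
      · rw [image_eq_zero_of_notMem_tsupport fun hc => hxi (hs i hc)]
        simp
    simp only [Finset.sum_const_zero, sub_zero] at hlim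
    exact hlim.congr fun n => (hφeq n x hx).symm
  · intro w hw M hM hwM n
    obtain ⟨W, hW, hWw⟩ := exists_continuous_extension hw
    rw [hint w W hW hWw, abs_neg, Finset.sum_mul]
    refine (Finset.abs_sum_le_sum_abs _ _).trans (Finset.sum_le_sum fun i _ => ?_)
    exact (hK i W hW).1 M hM (fun x hx => by
      rw [hWw (subset_closure hx)]; exact hwM x hx) n
  · intro w hw
    obtain ⟨W, hW, hWw⟩ := exists_continuous_extension hw
    choose b hbt hbl using fun i => (hK i W hW).2
    refine ⟨-∑ i, b i, ?_, ?_⟩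
    · simp only [hint w W hW hWw]
      exact (tendsto_finsetSum _ fun i _ => hbt i).neg
    · rw [abs_neg, Finset.sum_mul]
      refine (Finset.abs_sum_le_sum_abs _ _).trans (Finset.sum_le_sum fun i _ => ?_)
      refine (hbl i).trans (le_of_eq ?_)
      congr 1
      refine setIntegral_congr_fun isClosed_frontier.measurableSet fun x hx => ?_
      simp only [hWw (frontier_subset_closure hx)]

end Exhaustion

/-! ### Time slices, integration by parts and differentiation under the integral. -/

section Calculus

variable {d : ℕ} {D : Set (Space d)} {T : ℝ}

lemma isOpen_cylinder (hD : IsOpen D) : IsOpen (cylinder D T) := hD.prod isOpen_Ioo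

section Slices

variable {F : Type*} [NormedAddCommGroup F] [NormedSpace ℝ F] {g : Space d × ℝ → F}
  {z : Space d × ℝ}

lemma hasFDerivAt_slice (hD : IsOpen D) (hg : ContDiffOn ℝ 1 g (cylinder D T))
    (hz : z ∈ cylinder D T) : HasFDerivAt (fun y => g (y, z.2))
      ((fderiv ℝ g z).comp (ContinuousLinearMap.inl ℝ (Space d) ℝ)) z.1 := by
  have h1 : HasFDerivAt g (fderiv ℝ g z) z :=
    ((hg.contDiffAt ((isOpen_cylinder hD).mem_nhds hz)).differentiableAt (by simp)).hasFDerivAt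
  exact h1.comp (f := fun y => (y, z.2)) z.1 (hasFDerivAt_prodMk_left z.1 z.2)

lemma hasDerivAt_slice (hD : IsOpen D) (hg : ContDiffOn ℝ 1 g (cylinder D T))
    (hz : z ∈ cylinder D T) : HasDerivAt (fun s => g (z.1, s)) (fderiv ℝ g z (0, 1)) z.2 := by
  have h1 : HasFDerivAt g (fderiv ℝ g z) z :=
    ((hg.contDiffAt ((isOpen_cylinder hD).mem_nhds hz)).differentiableAt (by simp)).hasFDerivAt
  exact h1.comp_hasDerivAt (f := fun s => (z.1, s)) z.2
    ((hasDerivAt_const z.2 z.1).prodMk (hasDerivAt_id z.2))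

lemma continuousOn_fderiv_cylinder (hD : IsOpen D) (hg : ContDiffOn ℝ 1 g (cylinder D T)) :
    ContinuousOn (fderiv ℝ g) (cylinder D T) :=
  hg.continuousOn_fderiv_of_isOpen (isOpen_cylinder hD) le_rfl

lemma continuousOn_fderiv_slice (hD : IsOpen D) (hg : ContDiffOn ℝ 1 g (cylinder D T)) :
    ContinuousOn (fun z : Space d × ℝ => fderiv ℝ (fun y => g (y, z.2)) z.1)
      (cylinder D T) := by
  refine ((continuousOn_fderiv_cylinder hD hg).clm_comp
    (continuousOn_const (c := ContinuousLinearMap.inl ℝ (Space d) ℝ))).congr fun z hz => ?_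
  exact (hasFDerivAt_slice hD hg hz).fderiv

lemma differentiableAt_slice (hD : IsOpen D) (hg : ContDiffOn ℝ 1 g (cylinder D T))
    (hz : z ∈ cylinder D T) : DifferentiableAt ℝ (fun y => g (y, z.2)) z.1 :=
  (hasFDerivAt_slice hD hg hz).differentiableAt

omit [NormedSpace ℝ F] in
lemma continuousOn_slice {S : Set (Space d)} {I : Set ℝ} {t : ℝ} (hg : ContinuousOn g (S ×ˢ I))
    (ht : t ∈ I) : ContinuousOn (fun x => g (x, t)) S :=
  hg.comp (by fun_prop) fun _ hx => ⟨hx, ht⟩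

end Slices

variable {u : Space d × ℝ → Space d}

lemma continuousOn_spaceDeriv (hD : IsOpen D) (hu : ContDiffOn ℝ 1 u (cylinder D T)) :
    ContinuousOn (spaceDeriv u) (cylinder D T) :=
  continuousOn_fderiv_slice hD hu

lemma continuousOn_timeDeriv (hD : IsOpen D) (hu : ContDiffOn ℝ 1 u (cylinder D T)) :
    ContinuousOn (timeDeriv u) (cylinder D T) :=
  ((continuousOn_fderiv_cylinder hD hu).clm_apply continuousOn_const).congr fun _ hz =>
    (hasDerivAt_slice hD hu hz).deriv

lemma continuousOn_divergence (hD : IsOpen D) (hu : ContDiffOn ℝ 1 u (cylinder D T)) :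
    ContinuousOn (divergence u) (cylinder D T) := by
  refine continuousOn_finsetSum _ fun i _ => ?_
  have h := (continuousOn_spaceDeriv hD hu).clm_apply
    (continuousOn_const (c := EuclideanSpace.single i (1 : ℝ)))
  exact (EuclideanSpace.proj (𝕜 := ℝ) i).continuous.comp_continuousOn h

lemma continuousOn_spaceGrad (hD : IsOpen D) {p : Space d × ℝ → ℝ}
    (hp : ContDiffOn ℝ 1 p (cylinder D T)) : ContinuousOn (spaceGrad p) (cylinder D T) :=
  (InnerProductSpace.toDual ℝ (Space d)).symm.continuous.comp_continuousOn
    (continuousOn_fderiv_slice hD hp)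

lemma sum_apply_single_mul (L : Space d →L[ℝ] ℝ) (x : Space d) :
    ∑ i, L (EuclideanSpace.single i 1) * x i = L x := by
  conv_rhs => rw [← (EuclideanSpace.basisFun (Fin d) ℝ).sum_repr x]
  simp [mul_comm]

/-- The divergence of a vector field on `ℝ^d`. -/
def spaceDivergence (w : Space d → Space d) (x : Space d) : ℝ :=
  ∑ i : Fin d, (fderiv ℝ w x (EuclideanSpace.single i 1)) i

lemma continuous_mul_of_tsupport_subset {φ g : Space d → ℝ} (hD : IsOpen D) (hφ : Continuous φ)
    (hs : tsupport φ ⊆ D) (hg : ContinuousOn g D) : Continuous fun x => φ x * g x := by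
  refine ContinuousOn.continuous_of_tsupport_subset (s := D) ?_ hD ?_
  · exact hφ.continuousOn.mul hg
  · exact (closure_mono fun x hx => left_ne_zero_of_mul hx).trans hs

/-- Integration by parts in each coordinate. The field need only be C¹ inside D: every product
carries φ or its derivative, whose support is a compact subset of D, so no boundary term arises. -/
lemma integral_mul_spaceDivergence (hD : IsOpen D) {φ : Space d → ℝ} (hφ : ContDiff ℝ 1 φ)
    (hφc : HasCompactSupport φ) (hs : tsupport φ ⊆ D) {w : Space d → Space d}
    (hw : ContDiffOn ℝ 1 w D) :
    ∫ x, φ x * spaceDivergence w x = -∫ x, fderiv ℝ φ x (w x) := by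
  have hwd : ∀ x ∈ D, DifferentiableAt ℝ w x := fun x hx =>
    (hw.contDiffAt (hD.mem_nhds hx)).differentiableAt (by simp)
  have hwc : ∀ i, ContinuousOn (fun x => w x i) D := fun i =>
    (EuclideanSpace.proj (𝕜 := ℝ) i).continuous.comp_continuousOn hw.continuousOn
  have hdc : ∀ i, ContinuousOn (fun x => fderiv ℝ w x (EuclideanSpace.single i 1) i) D := fun i =>
    (EuclideanSpace.proj (𝕜 := ℝ) i).continuous.comp_continuousOn
      ((hw.continuousOn_fderiv_of_isOpen hD le_rfl).clm_apply continuousOn_const)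
  have hi1 : ∀ i, Integrable fun x => φ x * fderiv ℝ w x (EuclideanSpace.single i 1) i := fun i =>
    (continuous_mul_of_tsupport_subset hD hφ.continuous hs (hdc i)).integrable_of_hasCompactSupport
      hφc.mul_right
  have hi2 : ∀ i, Integrable fun x => fderiv ℝ φ x (EuclideanSpace.single i 1) * w x i := fun i =>
    (continuous_mul_of_tsupport_subset hD
      ((hφ.continuous_fderiv (by simp)).clm_apply continuous_const)
      ((tsupport_fderiv_apply_subset ℝ _).trans hs) (hwc i)).integrable_of_hasCompactSupport
      (hφc.fderiv_apply ℝ _).mul_right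
  have hi3 : ∀ i, Integrable fun x => φ x * w x i := fun i =>
    (continuous_mul_of_tsupport_subset hD hφ.continuous hs (hwc i)).integrable_of_hasCompactSupport
      hφc.mul_right
  have hder : ∀ i, ∀ x ∈ D, HasFDerivAt (fun x => w x i)
      ((EuclideanSpace.proj (𝕜 := ℝ) i).comp (fderiv ℝ w x)) x := fun i x hx =>
    (EuclideanSpace.proj (𝕜 := ℝ) i).hasFDerivAt.comp x (hwd x hx).hasFDerivAt
  have heq : ∀ i x, φ x * fderiv ℝ (fun x => w x i) x (EuclideanSpace.single i 1) =
      φ x * fderiv ℝ w x (EuclideanSpace.single i 1) i := by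
    intro i x
    by_cases hx : x ∈ D
    · rw [(hder i x hx).fderiv]
      rfl
    · rw [image_eq_zero_of_notMem_tsupport fun hc => hx (hs hc), zero_mul, zero_mul]
  calc ∫ x, φ x * spaceDivergence w x
      = ∑ i, ∫ x, φ x * fderiv ℝ w x (EuclideanSpace.single i 1) i := by
        rw [← integral_finsetSum _ fun i _ => hi1 i]
        simp only [spaceDivergence, Finset.mul_sum]
    _ = ∑ i, -∫ x, fderiv ℝ φ x (EuclideanSpace.single i 1) * w x i := by
        refine Finset.sum_congr rfl fun i _ => ?_
        simp only [← heq]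
        refine integral_mul_fderiv_eq_neg_fderiv_mul_of_integrable (hi2 i) ?_ (hi3 i)
          (fun x _ => hφ.differentiable (by simp) x) (fun x hx => (hder i x (hs hx)).differentiableAt)
        simp only [heq]
        exact hi1 i
    _ = -∫ x, fderiv ℝ φ x (w x) := by
        rw [Finset.sum_neg_distrib, ← integral_finsetSum _ fun i _ => hi2 i]
        simp only [sum_apply_single_mul]

lemma continuousOn_integral_cutoff {φ : Space d → ℝ} (hD : IsOpen D) (hφ : Continuous φ)
    (hφc : HasCompactSupport φ) (hs : tsupport φ ⊆ D) {h : Space d × ℝ → ℝ}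
    (hh : ContinuousOn h (cylinder D T)) :
    ContinuousOn (fun t => ∫ x, φ x * h (x, t)) (Ioo 0 T) := by
  refine continuousOn_integral_of_compact_support hφc.isCompact ?_ ?_
  · rintro ⟨t, x⟩ ⟨ht, -⟩
    refine ContinuousAt.continuousWithinAt ?_
    by_cases hx : x ∈ D
    · have h1 : ContinuousAt h (x, t) := hh.continuousAt ((isOpen_cylinder hD).mem_nhds ⟨hx, ht⟩)
      exact (hφ.comp continuous_snd).continuousAt.mul
        (ContinuousAt.comp (f := fun q : ℝ × Space d => (q.2, q.1)) h1 (by fun_prop))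
    · have hev : (fun q : ℝ × Space d => φ q.2 * h (q.2, q.1)) =ᶠ[𝓝 (t, x)] fun _ => 0 := by
        have : ∀ᶠ q : ℝ × Space d in 𝓝 (t, x), q.2 ∈ (tsupport φ)ᶜ :=
          continuous_snd.continuousAt.eventually
            ((isClosed_tsupport φ).isOpen_compl.mem_nhds fun hc => hx (hs hc))
        filter_upwards [this] with q hq
        rw [image_eq_zero_of_notMem_tsupport hq, zero_mul]
      exact (continuousAt_const (y := (0 : ℝ))).congr hev.symm
  · intro t x _ hx
    rw [image_eq_zero_of_notMem_tsupport hx, zero_mul]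

lemma hasDerivAt_integral_cutoff {φ : Space d → ℝ} (hD : IsOpen D) (hφ : Continuous φ)
    (hφc : HasCompactSupport φ) (hs : tsupport φ ⊆ D) {h h' : Space d × ℝ → ℝ}
    (hh : ContinuousOn h (cylinder D T)) (hh' : ContinuousOn h' (cylinder D T))
    (hd : ∀ x ∈ D, ∀ t ∈ Ioo 0 T, HasDerivAt (fun s => h (x, s)) (h' (x, t)) t)
    {t : ℝ} (ht : t ∈ Ioo 0 T) :
    HasDerivAt (fun t => ∫ x, φ x * h (x, t)) (∫ x, φ x * h' (x, t)) t := by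
  obtain ⟨δ, hδ, hδs⟩ := Metric.nhds_basis_closedBall.mem_iff.1 (isOpen_Ioo.mem_nhds ht)
  -- The time derivative may blow up at the boundary; the dominating bound comes from compactness of
  -- supp φ times a closed time interval inside (0, T).
  obtain ⟨C, hC⟩ := (hφc.isCompact.prod (isCompact_closedBall t δ)).exists_bound_of_continuousOn
    (hh'.mono (prod_mono hs hδs))
  have hcont : ∀ g : Space d × ℝ → ℝ, ContinuousOn g (cylinder D T) → ∀ s ∈ Ioo 0 T,
      Continuous fun x => φ x * g (x, s) := fun g hg s hs' =>
    continuous_mul_of_tsupport_subset hD hφ hs (continuousOn_slice hg hs')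
  refine (hasDerivAt_integral_of_dominated_loc_of_deriv_le (F := fun t x => φ x * h (x, t))
    (F' := fun t x => φ x * h' (x, t)) (bound := fun x => ‖φ x‖ * C)
    (Metric.ball_mem_nhds t hδ) ?_ ?_ ?_ ?_ ?_ ?_).2
  · filter_upwards [isOpen_Ioo.mem_nhds ht] with s hs' using
      (hcont h hh s hs').aestronglyMeasurable
  · exact (hcont h hh t ht).integrable_of_hasCompactSupport hφc.mul_right
  · exact (hcont h' hh' t ht).aestronglyMeasurable
  · refine Eventually.of_forall fun x s hs' => ?_
    rw [norm_mul]
    by_cases hx : x ∈ tsupport φ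
    · exact mul_le_mul_of_nonneg_left
        (hC (x, s) ⟨hx, Metric.ball_subset_closedBall hs'⟩) (norm_nonneg _)
    · simp [image_eq_zero_of_notMem_tsupport hx]
  · exact (hφ.norm.mul continuous_const).integrable_of_hasCompactSupport hφc.norm.mul_right
  · refine Eventually.of_forall fun x s hs' => ?_
    by_cases hx : x ∈ D
    · exact (hd x hx s (hδs (Metric.ball_subset_closedBall hs'))).const_mul (φ x)
    · simp only [image_eq_zero_of_notMem_tsupport fun hc => hx (hs hc), zero_mul]
      exact hasDerivAt_const s 0

end Calculus

/-! ### Integral forms of Grönwall and Cauchy–Schwarz. -/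

lemma integral_le_of_le_add_mul_integral {E : ℝ → ℝ} {T C A : ℝ} (hT : 0 ≤ T) (hC : 0 < C)
    (hA : 0 ≤ A) (hE : ContinuousOn E (Icc 0 T)) (hE0 : ∀ t ∈ Icc 0 T, 0 ≤ E t)
    (h : ∀ t ∈ Ico 0 T, E t ≤ A + C * ∫ s in (0 : ℝ)..t, E s) :
    ∫ s in (0 : ℝ)..T, E s ≤ (T + C * T ^ 2 * Real.exp (C * T)) * A := by
  -- Extending by the endpoint values makes the primitive differentiable at 0 and T as well.
  set E' : ℝ → ℝ := IccExtend hT ((Icc 0 T).domRestrict E) with hE'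
  have hEc : Continuous E' := hE.domRestrict.Icc_extend'
  have hEq : ∀ t ∈ Icc 0 T, E' t = E t := fun t ht => by
    simp [hE', IccExtend_of_mem hT _ ht]
  have hint : ∀ t ∈ Icc 0 T, ∫ s in (0 : ℝ)..t, E' s = ∫ s in (0 : ℝ)..t, E s := by
    intro t ht
    refine intervalIntegral.integral_congr fun s hs => hEq s ?_
    rw [uIcc_of_le ht.1] at hs
    exact ⟨hs.1, hs.2.trans ht.2⟩
  have hZ : ∀ t, HasDerivAt (fun t => ∫ s in (0 : ℝ)..t, E' s) (E' t) t := fun t =>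
    (hEc.integral_hasStrictDerivAt 0 t).hasDerivAt
  have hZ0 : ∀ t ∈ Icc 0 T, 0 ≤ ∫ s in (0 : ℝ)..t, E' s := by
    intro t ht
    refine intervalIntegral.integral_nonneg ht.1 fun s hs => ?_
    have hs' : s ∈ Icc 0 T := ⟨hs.1, hs.2.trans ht.2⟩
    rw [hEq s hs']
    exact hE0 s hs'
  -- Grönwall is applied to the primitive Z of E, which satisfies Z' ≤ A + C Z and Z(0) = 0, so that
  -- Z(T) ≤ A (exp(CT) - 1)/C.
  have hg := norm_le_gronwallBound_of_norm_deriv_right_le (f := fun t => ∫ s in (0 : ℝ)..t, E' s)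
    (f' := E') (δ := 0) (K := C) (ε := A) (a := 0) (b := T)
    (fun t _ => (hZ t).continuousAt.continuousWithinAt) (fun t _ => (hZ t).hasDerivWithinAt)
    (by simp) (fun t ht => by
      have ht' : t ∈ Icc 0 T := ⟨ht.1, ht.2.le⟩
      rw [Real.norm_of_nonneg (hZ0 t ht'), hint t ht', hEq t ht', Real.norm_of_nonneg (hE0 t ht')]
      linarith [h t ht]) T (right_mem_Icc.2 hT)
  rw [Real.norm_of_nonneg (hZ0 T (right_mem_Icc.2 hT)), hint T (right_mem_Icc.2 hT),
    gronwallBound_of_K_ne_0 hC.ne'] at hg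
  refine hg.trans ?_
  simp only [zero_mul, zero_add, sub_zero]
  -- Using eˣ - 1 ≤ x eˣ twice gives eˣ - 1 ≤ x + x² eˣ, the shape of the prefactor T + C T²
  -- exp(CT).
  have hexp : Real.exp (C * T) - 1 ≤ C * T * Real.exp (C * T) := by
    have h1 := Real.add_one_le_exp (-(C * T))
    have h2 := Real.exp_pos (C * T)
    have h3 : Real.exp (-(C * T)) * Real.exp (C * T) = 1 := by rw [← Real.exp_add]; simp
    nlinarith
  have hexp2 : Real.exp (C * T) - 1 ≤ C * T + C * T * (C * T * Real.exp (C * T)) := by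
    have : C * T * (Real.exp (C * T) - 1) ≤ C * T * (C * T * Real.exp (C * T)) := by gcongr
    linarith
  rw [div_mul_eq_mul_div, div_le_iff₀ hC]
  calc A * (Real.exp (C * T) - 1) ≤ A * (C * T + C * T * (C * T * Real.exp (C * T))) := by gcongr
    _ = _ := by ring

/-- Expand ∫ (m|f| - I)² ≥ 0, where m is the total mass and I = ∫ |f|, then cancel m; the case m = 0
is separate. -/
lemma integral_abs_le_sqrt {α : Type*} [MeasurableSpace α] {μ : Measure α} [IsFiniteMeasure μ]
    {f : α → ℝ} (hf : Integrable f μ) (hf2 : Integrable (fun x => f x ^ 2) μ) :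
    ∫ x, |f x| ∂μ ≤ Real.sqrt (μ.real univ) * Real.sqrt (∫ x, f x ^ 2 ∂μ) := by
  set m := μ.real univ with hm
  set I := ∫ x, |f x| ∂μ with hI
  have hI0 : 0 ≤ I := integral_nonneg fun x => abs_nonneg _
  have hm0 : 0 ≤ m := measureReal_nonneg
  have key : 0 ≤ m * (m * ∫ x, f x ^ 2 ∂μ) - m * I ^ 2 := by
    have h0 : 0 ≤ ∫ x, (m * |f x| - I) ^ 2 ∂μ := integral_nonneg fun x => sq_nonneg _
    have h1 : ∫ x, (m * |f x| - I) ^ 2 ∂μ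
        = m ^ 2 * (∫ x, f x ^ 2 ∂μ) - 2 * m * I * I + m * I ^ 2 := by
      have : ∀ x, (m * |f x| - I) ^ 2 = m ^ 2 * f x ^ 2 - 2 * m * I * |f x| + I ^ 2 := by
        intro x
        rw [← sq_abs (f x)]
        ring
      simp only [this]
      have i1 : Integrable (fun x => m ^ 2 * f x ^ 2 - 2 * m * I * |f x|) μ :=
        (hf2.const_mul _).sub (hf.abs.const_mul _)
      rw [integral_add i1 (integrable_const _), integral_sub (hf2.const_mul _) (hf.abs.const_mul _), integral_const_mul,
        integral_const_mul, integral_const, smul_eq_mul]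
    rw [h1] at h0
    linarith
  rw [← Real.sqrt_mul hm0]
  refine Real.le_sqrt_of_sq_le ?_
  rcases hm0.eq_or_lt with h | h
  · have : μ = 0 := by
      rw [← Measure.measure_univ_eq_zero]
      exact (measureReal_eq_zero_iff).1 h.symm
    simp [hI, this]
  · nlinarith [key, mul_pos h h]

/-! ### Integrals over S × (0, T), with S the domain or its boundary. -/

section SpaceTime

variable {d : ℕ} {ν : Measure (Space d)} [IsFiniteMeasure ν] {S : Set (Space d)} {T B : ℝ}
  {g : Space d × ℝ → ℝ}

lemma integrable_spaceTime (hS : MeasurableSet S) (hν : ∀ᵐ x ∂ν, x ∈ S)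
    (hg : ContinuousOn g (S ×ˢ Ioo 0 T)) (hB : ∀ z ∈ S ×ˢ Ioo 0 T, |g z| ≤ B) :
    Integrable g (ν.prod (volume.restrict (Ioo 0 T))) := by
  have he : ν.prod (volume.restrict (Ioo 0 T)) = (ν.prod volume).restrict (S ×ˢ Ioo 0 T) := by
    rw [← Measure.prod_restrict, Measure.restrict_eq_self_of_ae_mem hν]
  have hm := hS.prod (measurableSet_Ioo (a := (0 : ℝ)) (b := T))
  have hfin : IsFiniteMeasure ((ν.prod volume).restrict (S ×ˢ Ioo 0 T)) := by
    rw [← he]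
    infer_instance
  rw [he]
  refine Integrable.of_bound (hg.aestronglyMeasurable hm) B ?_
  filter_upwards [ae_restrict_mem hm] with z hz using hB z hz

lemma intervalIntegrable_spaceTime (hT : 0 ≤ T) (hS : MeasurableSet S) (hν : ∀ᵐ x ∂ν, x ∈ S)
    (hg : ContinuousOn g (S ×ˢ Ioo 0 T)) (hB : ∀ z ∈ S ×ˢ Ioo 0 T, |g z| ≤ B) :
    IntervalIntegrable (fun t => ∫ x, g (x, t) ∂ν) volume 0 T := by
  rw [intervalIntegrable_iff_integrableOn_Ioo_of_le hT]
  exact (integrable_spaceTime hS hν hg hB).integral_prod_right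

lemma integral_spaceTime (hT : 0 ≤ T) (hS : MeasurableSet S) (hν : ∀ᵐ x ∂ν, x ∈ S)
    (hg : ContinuousOn g (S ×ˢ Ioo 0 T)) (hB : ∀ z ∈ S ×ˢ Ioo 0 T, |g z| ≤ B) :
    ∫ t in (0 : ℝ)..T, ∫ x, g (x, t) ∂ν = ∫ z, g z ∂(ν.prod (volume.restrict (Ioo 0 T))) := by
  rw [integral_prod_symm _ (integrable_spaceTime hS hν hg hB), intervalIntegral.integral_of_le hT,
    integral_Ioc_eq_integral_Ioo]

lemma integral_abs_spaceTime_le (hT : 0 ≤ T) (hS : MeasurableSet S) (hν : ∀ᵐ x ∂ν, x ∈ S)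
    (hg : ContinuousOn g (S ×ˢ Ioo 0 T)) (hB : ∀ z ∈ S ×ˢ Ioo 0 T, |g z| ≤ B) :
    ∫ t in (0 : ℝ)..T, ∫ x, |g (x, t)| ∂ν ≤ Real.sqrt T * Real.sqrt (ν.real univ) *
      Real.sqrt (∫ t in (0 : ℝ)..T, ∫ x, g (x, t) ^ 2 ∂ν) := by
  have hB2 : ∀ z ∈ S ×ˢ Ioo 0 T, |g z ^ 2| ≤ B ^ 2 := fun z hz => by
    rw [abs_pow]
    exact pow_le_pow_left₀ (abs_nonneg _) (hB z hz) 2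
  rw [integral_spaceTime (g := fun z => |g z|) hT hS hν hg.abs (B := B)
      (fun z hz => by simpa using hB z hz),
    integral_spaceTime (g := fun z => g z ^ 2) hT hS hν (hg.pow 2) hB2]
  refine (integral_abs_le_sqrt (integrable_spaceTime hS hν hg hB)
    (integrable_spaceTime hS hν (hg.pow 2) hB2)).trans (le_of_eq ?_)
  congr 1
  rw [← univ_prod_univ, measureReal_prod_prod, mul_comm, Real.sqrt_mul (by positivity)]
  simp [hT]

end SpaceTime

/-! ### The pointwise energy balance. -/

section

/-- The regularity assumptions on the domain, the exact solution and the approximation. -/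
structure EnergySetting {d : ℕ} (D : Set (Space d)) (T : ℝ) (f : Space d × ℝ → Space d)
    (u₀ : Space d → Space d) (u : Space d × ℝ → Space d) (p : Space d × ℝ → ℝ)
    (us : Space d × ℝ → Space d) (ps : Space d × ℝ → ℝ) : Prop where
  isOpen : IsOpen D
  isBounded : Bornology.IsBounded D
  boundary : HasC1Boundary D
  time_pos : 0 < T
  forcing : ContDiffOn ℝ 1 f (cylinder D T)
  solution : IsClassicalSolution D T f u₀ u p
  velocity_contDiffOn : ContDiffOn ℝ 1 us (cylinder D T)
  velocity_continuousOn : ContinuousOn us (closedCylinder D T)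
  pressure_contDiffOn : ContDiffOn ℝ 1 ps (cylinder D T)
  pressure_continuousOn : ContinuousOn ps (closedCylinder D T)

variable {d : ℕ} {D : Set (Space d)} {T : ℝ} {f : Space d × ℝ → Space d}
  {u₀ : Space d → Space d} {u : Space d × ℝ → Space d} {p : Space d × ℝ → ℝ}
  {us : Space d × ℝ → Space d} {ps : Space d × ℝ → ℝ}

/-- The potential `‖u* - u‖² + 2 (p* - p)`. -/
def errPotential (u : Space d × ℝ → Space d) (p : Space d × ℝ → ℝ) (us : Space d × ℝ → Space d)
    (ps : Space d × ℝ → ℝ) (z : Space d × ℝ) : ℝ :=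
  ‖us z - u z‖ ^ 2 + 2 * (ps z - p z)

/-- The energy flux `‖u* - u‖² u* + 2 (p* - p) (u* - u)`. -/
def energyFlux (u : Space d × ℝ → Space d) (p : Space d × ℝ → ℝ) (us : Space d × ℝ → Space d)
    (ps : Space d × ℝ → ℝ) (z : Space d × ℝ) : Space d :=
  ‖us z - u z‖ ^ 2 • us z + (2 * (ps z - p z)) • (us z - u z)

/-- The rate of change of `‖u* - u‖²`. -/
def energyRate (u us : Space d × ℝ → Space d) (z : Space d × ℝ) : ℝ :=
  2 * inner ℝ (us z - u z) (timeDeriv us z - timeDeriv u z)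

/-- The source term of the energy balance. -/
def energySource (f : Space d × ℝ → Space d) (u : Space d × ℝ → Space d) (p : Space d × ℝ → ℝ)
    (us : Space d × ℝ → Space d) (ps : Space d × ℝ → ℝ) (z : Space d × ℝ) : ℝ :=
  2 * inner ℝ (us z - u z) (resVel f us ps z)
    - 2 * inner ℝ (us z - u z) (spaceDeriv u z (us z - u z))
    + resDiv us z * errPotential u p us ps z

lemma cylinder_subset_closedCylinder : cylinder D T ⊆ closedCylinder D T :=
  prod_mono subset_closure Ioo_subset_Icc_self

namespace EnergySetting

variable (h : EnergySetting D T f u₀ u p us ps)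
include h

/-- The exact pressure is only assumed differentiable in space. The momentum equation expresses ∇p
through f, uₜ and (u·∇)u, all continuous; this makes the flux C¹ in space, as integration by parts
requires. -/
lemma continuousOn_spaceGrad_pressure : ContinuousOn (spaceGrad p) (cylinder D T) := by
  have hu := h.solution.contDiffOn_velocity
  have hc : ContinuousOn (fun z => f z - (timeDeriv u z + spaceDeriv u z (u z)))
      (cylinder D T) :=
    h.forcing.continuousOn.sub ((continuousOn_timeDeriv h.isOpen hu).add
      ((continuousOn_spaceDeriv h.isOpen hu).clm_apply hu.continuousOn))
  refine hc.congr fun z hz => ?_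
  change spaceGrad p z = f z - (timeDeriv u z + spaceDeriv u z (u z))
  rw [← h.solution.momentum z hz, eulerOperator]
  abel

lemma contDiffOn_pressure_slice {t : ℝ} (ht : t ∈ Ioo 0 T) :
    ContDiffOn ℝ 1 (fun x => p (x, t)) D := by
  rw [← zero_add (1 : WithTop ℕ∞)]
  refine (contDiffOn_succ_iff_fderiv_of_isOpen h.isOpen).2
    ⟨fun x hx => ?_, by simp, contDiffOn_zero.2 ?_⟩
  · exact (h.solution.differentiable_pressure (x, t) ⟨hx, ht⟩).differentiableWithinAt
  · have h1 := (InnerProductSpace.toDual ℝ (Space d)).continuous.comp_continuousOn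
      (continuousOn_slice h.continuousOn_spaceGrad_pressure ht)
    refine h1.congr fun x hx => ?_
    simp [spaceGrad, gradient]

omit h in
lemma contDiffOn_slice {F : Type*} [NormedAddCommGroup F] [NormedSpace ℝ F] {g : Space d × ℝ → F}
    (hg : ContDiffOn ℝ 1 g (cylinder D T)) {t : ℝ} (ht : t ∈ Ioo 0 T) :
    ContDiffOn ℝ 1 (fun x => g (x, t)) D :=
  hg.comp (by fun_prop) fun _ hx => ⟨hx, ht⟩

lemma contDiffOn_flux_slice {t : ℝ} (ht : t ∈ Ioo 0 T) :
    ContDiffOn ℝ 1 (fun x => energyFlux u p us ps (x, t)) D := by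
  have h1 := contDiffOn_slice h.solution.contDiffOn_velocity ht
  have h2 := contDiffOn_slice h.velocity_contDiffOn ht
  have h3 := contDiffOn_slice h.pressure_contDiffOn ht
  have h4 := h.contDiffOn_pressure_slice ht
  exact (((h2.sub h1).norm_sq ℝ).smul h2).add ((contDiffOn_const.mul (h3.sub h4)).smul (h2.sub h1))

/-- The pointwise energy balance. -/
lemma spaceDivergence_flux {x : Space d} {t : ℝ} (hx : x ∈ D) (ht : t ∈ Ioo 0 T) :
    spaceDivergence (fun y => energyFlux u p us ps (y, t)) x =
      energySource f u p us ps (x, t) - energyRate u us (x, t) := by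
  have hz : (x, t) ∈ cylinder D T := ⟨hx, ht⟩
  have hA : HasFDerivAt (fun y => u (y, t)) (spaceDeriv u (x, t)) x :=
    (differentiableAt_slice h.isOpen h.solution.contDiffOn_velocity hz).hasFDerivAt
  have hAs : HasFDerivAt (fun y => us (y, t)) (spaceDeriv us (x, t)) x :=
    (differentiableAt_slice h.isOpen h.velocity_contDiffOn hz).hasFDerivAt
  have hl : HasFDerivAt (fun y => p (y, t)) (fderiv ℝ (fun y => p (y, t)) x) x :=
    (h.solution.differentiable_pressure (x, t) hz).hasFDerivAt
  have hls : HasFDerivAt (fun y => ps (y, t)) (fderiv ℝ (fun y => ps (y, t)) x) x :=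
    (differentiableAt_slice h.isOpen h.pressure_contDiffOn hz).hasFDerivAt
  have hgp : ∀ v, inner ℝ v (spaceGrad p (x, t)) = fderiv ℝ (fun y => p (y, t)) x v := by
    intro v
    rw [real_inner_comm, spaceGrad, gradient, InnerProductSpace.toDual_symm_apply]
  have hgps : ∀ v, inner ℝ v (spaceGrad ps (x, t)) = fderiv ℝ (fun y => ps (y, t)) x v := by
    intro v
    rw [real_inner_comm, spaceGrad, gradient, InnerProductSpace.toDual_symm_apply]
  have hm := h.solution.momentum _ hz
  have hdiv : ∑ i, spaceDeriv u (x, t) (EuclideanSpace.single i 1) i = 0 :=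
    h.solution.divergence_free _ hz
  have hdivs : ∑ i, spaceDeriv us (x, t) (EuclideanSpace.single i 1) i = resDiv us (x, t) := rfl
  set A := spaceDeriv u (x, t)
  set As := spaceDeriv us (x, t)
  set l := fderiv ℝ (fun y => p (y, t)) x
  set ls := fderiv ℝ (fun y => ps (y, t)) x
  set v := us (x, t) - u (x, t) with hv
  have hw : HasFDerivAt (fun y => energyFlux u p us ps (y, t)) _ x :=
    ((hAs.sub hA).norm_sq.smul hAs).add (((hls.sub hl).const_mul 2).smul (hAs.sub hA))
  -- Product rule in each component. After summation the diagonal entries become divergences, and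
  -- the products with components of `us` and `v` become directional derivatives.
  have e1 : ∀ i, fderiv ℝ (fun y => energyFlux u p us ps (y, t)) x (EuclideanSpace.single i 1) i
      = ‖v‖ ^ 2 * As (EuclideanSpace.single i 1) i
        + 2 * (((innerSL ℝ v).comp (As - A)) (EuclideanSpace.single i 1) * us (x, t) i)
        + 2 * (ps (x, t) - p (x, t)) *
          (As (EuclideanSpace.single i 1) i - A (EuclideanSpace.single i 1) i)
        + 2 * ((ls - l) (EuclideanSpace.single i 1) * v i) := by
    intro i
    rw [hw.fderiv]
    simp [hv]
    ring
  rw [spaceDivergence, Finset.sum_congr rfl fun i _ => e1 i]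
  simp only [Finset.sum_add_distrib, ← Finset.mul_sum, Finset.sum_sub_distrib,
    sum_apply_single_mul, hdiv, hdivs]
  -- Eliminating f by the exact momentum equation cancels the time derivatives; what remains is 2
  -- v·((u*·∇)v + ∇(p* - p)) plus the divergence residual term.
  have e2 : energySource f u p us ps (x, t) - energyRate u us (x, t) =
      2 * inner ℝ v (As (us (x, t)) - A (us (x, t)) + (spaceGrad ps (x, t) - spaceGrad p (x, t)))
      + resDiv us (x, t) * (‖v‖ ^ 2 + 2 * (ps (x, t) - p (x, t))) := by
    have : As (us (x, t)) - A (us (x, t)) + (spaceGrad ps (x, t) - spaceGrad p (x, t)) =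
        resVel f us ps (x, t) - A v - (timeDeriv us (x, t) - timeDeriv u (x, t)) := by
      rw [resVel, ← hm, eulerOperator, eulerOperator, hv, map_sub]
      abel
    rw [this, inner_sub_right, inner_sub_right]
    change 2 * inner ℝ v (resVel f us ps (x, t)) - 2 * inner ℝ v (A v) +
      resDiv us (x, t) * (‖v‖ ^ 2 + 2 * (ps (x, t) - p (x, t))) -
      2 * inner ℝ v (timeDeriv us (x, t) - timeDeriv u (x, t)) = _
    ring
  rw [e2, inner_add_right, inner_sub_right v (spaceGrad ps (x, t)), hgp, hgps,
    inner_sub_right v (As (us (x, t)))]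
  simp
  ring

lemma continuousOn_source : ContinuousOn (energySource f u p us ps) (cylinder D T) := by
  have hu := h.solution.contDiffOn_velocity
  have hv := h.velocity_contDiffOn.continuousOn.sub hu.continuousOn
  have hr : ContinuousOn (resVel f us ps) (cylinder D T) :=
    (((continuousOn_timeDeriv h.isOpen h.velocity_contDiffOn).add
      ((continuousOn_spaceDeriv h.isOpen h.velocity_contDiffOn).clm_apply
        h.velocity_contDiffOn.continuousOn)).add
      (continuousOn_spaceGrad h.isOpen h.pressure_contDiffOn)).sub h.forcing.continuousOn
  have hp := h.solution.continuousOn_pressure.mono cylinder_subset_closedCylinder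
  exact ((continuousOn_const.mul (hv.inner hr)).sub (continuousOn_const.mul
    (hv.inner ((continuousOn_spaceDeriv h.isOpen hu).clm_apply hv)))).add
    ((continuousOn_divergence h.isOpen h.velocity_contDiffOn).mul ((hv.norm.pow 2).add
      (continuousOn_const.mul (h.pressure_contDiffOn.continuousOn.sub hp))))

lemma continuousOn_rate : ContinuousOn (energyRate u us) (cylinder D T) := by
  have hu := h.solution.contDiffOn_velocity
  exact continuousOn_const.mul ((h.velocity_contDiffOn.continuousOn.sub hu.continuousOn).inner
    ((continuousOn_timeDeriv h.isOpen h.velocity_contDiffOn).sub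
      (continuousOn_timeDeriv h.isOpen hu)))

lemma hasDerivAt_normSq {x : Space d} {t : ℝ} (hx : x ∈ D) (ht : t ∈ Ioo 0 T) :
    HasDerivAt (fun s => ‖us (x, s) - u (x, s)‖ ^ 2) (energyRate u us (x, t)) t := by
  have hz : (x, t) ∈ cylinder D T := ⟨hx, ht⟩
  have h1 : HasDerivAt (fun s => u (x, s)) (timeDeriv u (x, t)) t :=
    (hasDerivAt_slice h.isOpen h.solution.contDiffOn_velocity hz).differentiableAt.hasDerivAt
  have h2 : HasDerivAt (fun s => us (x, s)) (timeDeriv us (x, t)) t :=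
    (hasDerivAt_slice h.isOpen h.velocity_contDiffOn hz).differentiableAt.hasDerivAt
  exact (h2.sub h1).norm_sq

lemma continuousOn_normSq : ContinuousOn (fun z => ‖us z - u z‖ ^ 2) (closedCylinder D T) :=
  ((h.velocity_continuousOn.sub h.solution.continuousOn_velocity).norm).pow 2

lemma continuousOn_flux : ContinuousOn (energyFlux u p us ps) (closedCylinder D T) :=
  (h.continuousOn_normSq.smul h.velocity_continuousOn).add ((continuousOn_const.mul
    (h.pressure_continuousOn.sub h.solution.continuousOn_pressure)).smul
    (h.velocity_continuousOn.sub h.solution.continuousOn_velocity))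

/-- The energy balance weighted with a cutoff function. -/
lemma integral_cutoff_rate {φ : Space d → ℝ} (hφ : ContDiff ℝ 1 φ) (hφc : HasCompactSupport φ)
    (hs : tsupport φ ⊆ D) {t : ℝ} (ht : t ∈ Ioo 0 T) :
    ∫ x, φ x * energyRate u us (x, t) = (∫ x, φ x * energySource f u p us ps (x, t))
      + ∫ x, fderiv ℝ φ x (energyFlux u p us ps (x, t)) := by
  have hibp := integral_mul_spaceDivergence h.isOpen hφ hφc hs (h.contDiffOn_flux_slice ht)
  have hi : ∀ g : Space d × ℝ → ℝ, ContinuousOn g (cylinder D T) →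
      Integrable fun x => φ x * g (x, t) := fun g hg =>
    (continuous_mul_of_tsupport_subset h.isOpen hφ.continuous hs
      (continuousOn_slice hg ht)).integrable_of_hasCompactSupport hφc.mul_right
  have heq : ∫ x, φ x * spaceDivergence (fun y => energyFlux u p us ps (y, t)) x =
      (∫ x, φ x * energySource f u p us ps (x, t)) - ∫ x, φ x * energyRate u us (x, t) := by
    rw [← integral_sub (hi _ h.continuousOn_source) (hi _ h.continuousOn_rate)]
    refine integral_congr_ae (Eventually.of_forall fun x => ?_)
    by_cases hx : x ∈ D
    · simp only [h.spaceDivergence_flux hx ht, mul_sub]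
    · simp [image_eq_zero_of_notMem_tsupport fun hc => hx (hs hc)]
  rw [heq] at hibp
  linarith

end EnergySetting

end

/-! ### The energy inequality integrated over the domain. -/

section

variable {d : ℕ} {D : Set (Space d)} {T : ℝ} {f : Space d × ℝ → Space d}
  {u₀ : Space d → Space d} {u : Space d × ℝ → Space d} {p : Space d × ℝ → ℝ}
  {us : Space d × ℝ → Space d} {ps : Space d × ℝ → ℝ}

/-- The squared `L²` distance of the two velocities at time `t`. -/
def errEnergy (D : Set (Space d)) (u us : Space d × ℝ → Space d) (t : ℝ) : ℝ :=
  ∫ x in D, ‖us (x, t) - u (x, t)‖ ^ 2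

lemma ae_surfaceMeasure_mem : ∀ᵐ x ∂(surfaceMeasure D), x ∈ frontier D :=
  ae_restrict_mem isClosed_frontier.measurableSet

lemma isCompact_closedCylinder (hb : Bornology.IsBounded D) : IsCompact (closedCylinder D T) :=
  hb.isCompact_closure.prod isCompact_Icc

namespace EnergySetting

variable (h : EnergySetting D T f u₀ u p us ps)
include h

lemma volume_lt_top : volume D < ⊤ := h.isBounded.measure_lt_top

lemma isFiniteMeasure_restrict : IsFiniteMeasure (volume.restrict D) :=
  ⟨by simpa using h.volume_lt_top⟩

lemma isFiniteMeasure_surface : IsFiniteMeasure (surfaceMeasure D) :=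
  ⟨surfaceMeasure_univ_lt_top h.isOpen h.isBounded h.boundary⟩

lemma exists_normSq_bound : ∃ B, ∀ z ∈ closedCylinder D T, ‖us z - u z‖ ^ 2 ≤ B := by
  obtain ⟨B, hB⟩ := (isCompact_closedCylinder h.isBounded).exists_bound_of_continuousOn
    h.continuousOn_normSq
  exact ⟨B, fun z hz => (le_abs_self _).trans (hB z hz)⟩

lemma continuousOn_errEnergy : ContinuousOn (errEnergy D u us) (Icc 0 T) := by
  have := h.isFiniteMeasure_restrict
  obtain ⟨B, hB⟩ := h.exists_normSq_bound
  refine continuousOn_of_dominated (bound := fun _ => B) (fun t ht => ?_) (fun t ht => ?_)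
    (integrable_const B) ?_
  · exact (continuousOn_slice (h.continuousOn_normSq.mono (prod_mono subset_closure subset_rfl))
      ht).aestronglyMeasurable h.isOpen.measurableSet
  · filter_upwards [ae_restrict_mem h.isOpen.measurableSet] with x hx
    rw [Real.norm_of_nonneg (by positivity)]
    exact hB (x, t) ⟨subset_closure hx, ht⟩
  · filter_upwards [ae_restrict_mem h.isOpen.measurableSet] with x hx
    exact h.continuousOn_normSq.comp (f := fun t => (x, t)) (by fun_prop)
      fun t ht => ⟨subset_closure hx, ht⟩

lemma tendsto_integral_cutoff {φ : ℕ → Space d → ℝ} {K : ℝ} (hφ : IsCutoffSequence D φ K) {t : ℝ}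
    (ht : t ∈ Icc 0 T) :
    Tendsto (fun n => ∫ x, φ n x * ‖us (x, t) - u (x, t)‖ ^ 2) atTop
      (𝓝 (errEnergy D u us t)) := by
  have := h.isFiniteMeasure_restrict
  obtain ⟨B, hB⟩ := h.exists_normSq_bound
  have hsupp : ∀ n, ∫ x, φ n x * ‖us (x, t) - u (x, t)‖ ^ 2 =
      ∫ x in D, φ n x * ‖us (x, t) - u (x, t)‖ ^ 2 := fun n =>
    (setIntegral_eq_integral_of_forall_compl_eq_zero fun x hx => by
      rw [image_eq_zero_of_notMem_tsupport fun hc => hx (hφ.tsupport_subset n hc), zero_mul]).symm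
  simp only [hsupp]
  refine tendsto_integral_of_dominated_convergence (fun _ => B) (fun n => ?_) (integrable_const B)
    (fun n => ?_) ?_
  · exact (((hφ.contDiff n).continuous.continuousOn).mul (continuousOn_slice
      (h.continuousOn_normSq.mono (prod_mono subset_closure subset_rfl)) ht)).aestronglyMeasurable
      h.isOpen.measurableSet
  · filter_upwards [ae_restrict_mem h.isOpen.measurableSet] with x hx
    rw [Real.norm_of_nonneg (mul_nonneg (hφ.nonneg n x) (by positivity))]
    exact (mul_le_of_le_one_left (by positivity) (hφ.le_one n x)).trans
      (hB (x, t) ⟨subset_closure hx, ht⟩)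
  · filter_upwards [ae_restrict_mem h.isOpen.measurableSet] with x hx
    simpa using (hφ.tendsto_one x hx).mul_const (‖us (x, t) - u (x, t)‖ ^ 2)

lemma continuousOn_normal_flux : ContinuousOn
    (fun z => |inner ℝ (energyFlux u p us ps z) (outwardNormal D z.1)|)
    (frontier D ×ˢ Icc 0 T) := by
  refine ((h.continuousOn_flux.mono (prod_mono frontier_subset_closure subset_rfl)).inner ?_).abs
  exact (continuousOn_outwardNormal h.isOpen h.boundary).comp continuousOn_fst fun z hz => hz.1

lemma intervalIntegrable_normal_flux : IntervalIntegrable (fun t => ∫ x,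
    |inner ℝ (energyFlux u p us ps (x, t)) (outwardNormal D x)| ∂(surfaceMeasure D))
    volume 0 T := by
  have := h.isFiniteMeasure_surface
  obtain ⟨B, hB⟩ := ((isCompact_frontier h.isBounded).prod
    (isCompact_Icc (a := 0) (b := T))).exists_bound_of_continuousOn h.continuousOn_normal_flux
  exact intervalIntegrable_spaceTime h.time_pos.le isClosed_frontier.measurableSet
    ae_surfaceMeasure_mem
    (h.continuousOn_normal_flux.mono (prod_mono subset_rfl Ioo_subset_Icc_self))
    fun z hz => hB z (prod_mono subset_rfl Ioo_subset_Icc_self hz)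

/-- The source may change sign, so it is replaced by a nonnegative majorant `g` before the cutoff is
dropped using φ ≤ 1. -/
lemma cutoff_rate_le {g : Space d × ℝ → ℝ} {B : ℝ} (hg : ContinuousOn g (cylinder D T))
    (hB : ∀ z ∈ cylinder D T, |g z| ≤ B) (hg0 : ∀ z ∈ cylinder D T, 0 ≤ g z)
    (hsrc : ∀ z ∈ cylinder D T, energySource f u p us ps z ≤ g z) {φ : ℕ → Space d → ℝ} {K : ℝ}
    (hφ : IsCutoffSequence D φ K) (n : ℕ) {t : ℝ} (ht : t ∈ Ioo 0 T) :
    ∫ x, φ n x * energyRate u us (x, t) ≤ (∫ x in D, g (x, t)) +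
      ∫ x in D, fderiv ℝ (φ n) x (energyFlux u p us ps (x, t)) := by
  have := h.isFiniteMeasure_restrict
  rw [h.integral_cutoff_rate (hφ.contDiff n) (hφ.hasCompactSupport n) (hφ.tsupport_subset n) ht]
  refine add_le_add ?_ (le_of_eq ?_)
  · rw [← setIntegral_eq_integral_of_forall_compl_eq_zero (s := D) fun x hx => by
      rw [image_eq_zero_of_notMem_tsupport fun hc => hx (hφ.tsupport_subset n hc), zero_mul]]
    refine setIntegral_mono_on ?_ ?_ h.isOpen.measurableSet fun x hx => ?_
    · exact ((continuous_mul_of_tsupport_subset h.isOpen (hφ.contDiff n).continuous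
        (hφ.tsupport_subset n) (continuousOn_slice h.continuousOn_source
        ht)).integrable_of_hasCompactSupport (hφ.hasCompactSupport n).mul_right).integrableOn
    · refine Integrable.of_bound ((continuousOn_slice hg ht).aestronglyMeasurable
        h.isOpen.measurableSet) B ?_
      filter_upwards [ae_restrict_mem h.isOpen.measurableSet] with x hx using hB _ ⟨hx, ht⟩
    · exact (mul_le_mul_of_nonneg_left (hsrc _ ⟨hx, ht⟩) (hφ.nonneg n x)).trans
        (mul_le_of_le_one_left (hg0 _ ⟨hx, ht⟩) (hφ.le_one n x))
  · refine (setIntegral_eq_integral_of_forall_compl_eq_zero fun x hx => ?_).symm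
    have : fderiv ℝ (φ n) x = 0 := image_eq_zero_of_notMem_tsupport fun hc =>
      hx (hφ.tsupport_subset n (tsupport_fderiv_subset ℝ hc))
    simp [this]

/-- The energy inequality between two times. -/
lemma errEnergy_le {g : Space d × ℝ → ℝ} {B : ℝ} (hg : ContinuousOn g (cylinder D T))
    (hB : ∀ z ∈ cylinder D T, |g z| ≤ B) (hg0 : ∀ z ∈ cylinder D T, 0 ≤ g z)
    (hsrc : ∀ z ∈ cylinder D T, energySource f u p us ps z ≤ g z) {φ : ℕ → Space d → ℝ} {K : ℝ}
    (hφ : IsCutoffSequence D φ K) {s t : ℝ} (hs : 0 < s) (hst : s ≤ t) (ht : t < T) :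
    errEnergy D u us t ≤ errEnergy D u us s + (∫ τ in s..t, ∫ x in D, g (x, τ)) +
      K * ∫ τ in s..t, ∫ x, |inner ℝ (energyFlux u p us ps (x, τ)) (outwardNormal D x)|
        ∂(surfaceMeasure D) := by
  have := h.isFiniteMeasure_restrict
  have hsub : Icc s t ⊆ Ioo 0 T := fun τ hτ => ⟨hs.trans_le hτ.1, hτ.2.trans_lt ht⟩
  have hsub' : uIcc s t ⊆ uIcc 0 T := by
    rw [uIcc_of_le hst, uIcc_of_le h.time_pos.le]
    exact hsub.trans Ioo_subset_Icc_self
  have hwc : ∀ τ ∈ Ioo 0 T, ContinuousOn (fun x => energyFlux u p us ps (x, τ)) (closure D) :=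
    fun τ hτ => continuousOn_slice h.continuousOn_flux (Ioo_subset_Icc_self hτ)
  obtain ⟨W, hW⟩ := (isCompact_closedCylinder h.isBounded).exists_bound_of_continuousOn
    h.continuousOn_flux
  have hW0 : ∀ z ∈ closedCylinder D T, ‖energyFlux u p us ps z‖ ≤ max W 0 := fun z hz =>
    (hW z hz).trans (le_max_left _ _)
  set a : ℕ → ℝ → ℝ := fun n τ => ∫ x in D, fderiv ℝ (φ n) x (energyFlux u p us ps (x, τ)) with ha
  have hac : ∀ n, ContinuousOn (a n) (Ioo 0 T) := by
    intro n
    refine continuousOn_of_dominated (bound := fun x => ‖fderiv ℝ (φ n) x‖ * max W 0)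
      (fun τ hτ => ?_) (fun τ hτ => ?_) ?_ ?_
    · exact (((hφ.contDiff n).continuous_fderiv (by simp)).continuousOn.clm_apply
        ((hwc τ hτ).mono subset_closure)).aestronglyMeasurable h.isOpen.measurableSet
    · filter_upwards [ae_restrict_mem h.isOpen.measurableSet] with x hx
      exact (fderiv ℝ (φ n) x).le_opNorm_of_le
        (hW0 (x, τ) ⟨subset_closure hx, Ioo_subset_Icc_self hτ⟩)
    · exact ((((hφ.contDiff n).continuous_fderiv (by simp)).norm.integrable_of_hasCompactSupport
        ((hφ.hasCompactSupport n).fderiv ℝ).norm).mul_const _).integrableOn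
    · filter_upwards [ae_restrict_mem h.isOpen.measurableSet] with x hx
      refine continuousOn_const.clm_apply ?_
      exact h.continuousOn_flux.comp (f := fun t => (x, t)) (by fun_prop)
        fun t ht => ⟨subset_closure hx, Ioo_subset_Icc_self ht⟩
  have hai : ∀ n, IntervalIntegrable (a n) volume s t := fun n =>
    ((hac n).mono (by rwa [uIcc_of_le hst])).intervalIntegrable
  have hgi : IntervalIntegrable (fun τ => ∫ x in D, g (x, τ)) volume s t :=
    (intervalIntegrable_spaceTime h.time_pos.le h.isOpen.measurableSet
      (ae_restrict_mem h.isOpen.measurableSet) hg hB).mono_set hsub'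
  have hni := h.intervalIntegrable_normal_flux.mono_set hsub'
  -- The bound uniform in n and τ is what permits dominated convergence in time.
  have hab : ∀ n, ∀ τ ∈ Ioo 0 T, |a n τ| ≤ K * max W 0 := fun n τ hτ =>
    hφ.abs_integral_le _ (hwc τ hτ) _ (le_max_right _ _)
      (fun x hx => hW0 (x, τ) ⟨subset_closure hx, Ioo_subset_Icc_self hτ⟩) n
  choose! b hbt hbl using fun (τ : ℝ) (hτ : τ ∈ Ioo 0 T) => hφ.exists_flux _ (hwc τ hτ)
  have hIoc : uIoc s t ⊆ Ioo 0 T := by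
    rw [uIoc_of_le hst]
    exact Ioc_subset_Icc_self.trans hsub
  have hlim : Tendsto (fun n => ∫ τ in s..t, a n τ) atTop (𝓝 (∫ τ in s..t, b τ)) := by
    refine intervalIntegral.tendsto_integral_filter_of_dominated_convergence
      (fun _ => K * max W 0) (Eventually.of_forall fun n => ?_) (Eventually.of_forall fun n => ?_)
      intervalIntegrable_const ?_
    · exact ((hac n).mono hIoc).aestronglyMeasurable measurableSet_uIoc
    · exact Eventually.of_forall fun τ hτ => hab n τ (hIoc hτ)
    · exact Eventually.of_forall fun τ hτ => hbt τ (hIoc hτ)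
  -- `b` is chosen separately at each time; its measurability comes from being the pointwise limit
  -- of the `a n`.
  have hbi : IntervalIntegrable b volume s t := by
    rw [intervalIntegrable_iff]
    have : IsFiniteMeasure (volume.restrict (uIoc s t)) :=
      ⟨by rw [Measure.restrict_apply_univ, uIoc_of_le hst]; exact measure_Ioc_lt_top⟩
    refine Integrable.of_bound (C := K * max W 0) (aestronglyMeasurable_of_tendsto_ae atTop
      (f := a) (fun n => ((hac n).mono hIoc).aestronglyMeasurable measurableSet_uIoc) ?_) ?_
    · filter_upwards [ae_restrict_mem measurableSet_uIoc] with τ hτ using hbt τ (hIoc hτ)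
    · filter_upwards [ae_restrict_mem measurableSet_uIoc] with τ hτ
      exact le_of_tendsto (hbt τ (hIoc hτ)).abs
        (Eventually.of_forall fun n => hab n τ (hIoc hτ))
  have hble : ∫ τ in s..t, b τ ≤ K * ∫ τ in s..t, ∫ x,
      |inner ℝ (energyFlux u p us ps (x, τ)) (outwardNormal D x)| ∂(surfaceMeasure D) := by
    rw [← intervalIntegral.integral_const_mul]
    exact intervalIntegral.integral_mono_on hst hbi (hni.const_mul K) fun τ hτ =>
      (le_abs_self _).trans (hbl τ (hsub hτ))
  -- For fixed n this is the fundamental theorem of calculus for the cutoff energy; letting n grow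
  -- then gives the claim.
  have hstep : ∀ n, (∫ x, φ n x * ‖us (x, t) - u (x, t)‖ ^ 2) -
      (∫ x, φ n x * ‖us (x, s) - u (x, s)‖ ^ 2) ≤
        (∫ τ in s..t, ∫ x in D, g (x, τ)) + ∫ τ in s..t, a n τ := by
    intro n
    have hnc := h.continuousOn_normSq.mono cylinder_subset_closedCylinder
    have hri : IntervalIntegrable (fun τ => ∫ x, φ n x * energyRate u us (x, τ)) volume s t :=
      ((continuousOn_integral_cutoff h.isOpen (hφ.contDiff n).continuous (hφ.hasCompactSupport n)
        (hφ.tsupport_subset n) h.continuousOn_rate).mono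
        (by rwa [uIcc_of_le hst])).intervalIntegrable
    rw [← intervalIntegral.integral_eq_sub_of_hasDerivAt (fun τ hτ =>
      hasDerivAt_integral_cutoff h.isOpen (hφ.contDiff n).continuous (hφ.hasCompactSupport n)
        (hφ.tsupport_subset n) hnc h.continuousOn_rate (fun x hx t ht => h.hasDerivAt_normSq hx ht)
        (hsub (by rwa [uIcc_of_le hst] at hτ))) hri, ← intervalIntegral.integral_add hgi (hai n)]
    exact intervalIntegral.integral_mono_on hst hri (hgi.add (hai n)) fun τ hτ =>
      h.cutoff_rate_le hg hB hg0 hsrc hφ n (hsub hτ)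
  have hfin := le_of_tendsto_of_tendsto'
    ((h.tendsto_integral_cutoff hφ (Ioo_subset_Icc_self (hsub (right_mem_Icc.2 hst)))).sub
      (h.tendsto_integral_cutoff hφ (Ioo_subset_Icc_self (hsub (left_mem_Icc.2 hst)))))
    (hlim.const_add _) hstep
  linarith

end EnergySetting

end

/-! ### Residual bounds and the Grönwall estimate. -/

section

variable {d : ℕ} {D : Set (Space d)} {T : ℝ} {f : Space d × ℝ → Space d}
  {u₀ : Space d → Space d} {u : Space d × ℝ → Space d} {p : Space d × ℝ → ℝ}
  {us : Space d × ℝ → Space d} {ps : Space d × ℝ → ℝ}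

lemma norm_le_supNorm {F : Type*} [NormedAddCommGroup F] (hb : Bornology.IsBounded D)
    {v : Space d × ℝ → F} (hv : ContinuousOn v (closedCylinder D T)) {z : Space d × ℝ}
    (hz : z ∈ closedCylinder D T) : ‖v z‖ ≤ supNorm D T v :=
  le_csSup ((isCompact_closedCylinder hb).bddAbove_image hv.norm) (mem_image_of_mem _ hz)

lemma MemCk.continuousOn_and_bounded {V : Type*} [NormedAddCommGroup V] [NormedSpace ℝ V] {m : ℕ} {S : Set V}
    {g : V → ℝ} (h : MemCk m S g) : ContinuousOn g S ∧ ∃ B, ∀ z ∈ S, |g z| ≤ B := by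
  obtain ⟨B, -, hc, hB⟩ := h
  refine ⟨hc.continuousOn, B, fun z hz => ?_⟩
  simpa using hB 0 (Nat.zero_le m) z hz

namespace EnergySetting

variable (h : EnergySetting D T f u₀ u p us ps)
include h

lemma abs_errPotential_le {z : Space d × ℝ} (hz : z ∈ closedCylinder D T) :
    |errPotential u p us ps z| ≤ (|supNorm D T u| + |supNorm D T us|) ^ 2 +
      2 * (|supNorm D T p| + |supNorm D T ps|) := by
  have h1 := (norm_le_supNorm h.isBounded h.solution.continuousOn_velocity hz).trans (le_abs_self _)
  have h2 := (norm_le_supNorm h.isBounded h.velocity_continuousOn hz).trans (le_abs_self _)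
  have h3 := (norm_le_supNorm h.isBounded h.solution.continuousOn_pressure hz).trans (le_abs_self _)
  have h4 := (norm_le_supNorm h.isBounded h.pressure_continuousOn hz).trans (le_abs_self _)
  have h5 : ‖us z - u z‖ ≤ |supNorm D T u| + |supNorm D T us| :=
    (norm_sub_le _ _).trans (by linarith)
  have h6 : |ps z - p z| ≤ |supNorm D T p| + |supNorm D T ps| :=
    (norm_sub_le (ps z) (p z)).trans (by linarith)
  calc |errPotential u p us ps z| ≤ |‖us z - u z‖ ^ 2| + |2 * (ps z - p z)| := abs_add_le _ _
    _ = ‖us z - u z‖ ^ 2 + 2 * |ps z - p z| := by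
        rw [abs_of_nonneg (by positivity), abs_mul, abs_two]
    _ ≤ _ := by gcongr

/-- Since u·n = 0, the vectors u* and u* - u have the same normal component, so it factors out of
both terms of the flux. -/
lemma inner_flux_outwardNormal {x : Space d} {t : ℝ} (hx : x ∈ frontier D) (ht : t ∈ Ioo 0 T) :
    inner ℝ (energyFlux u p us ps (x, t)) (outwardNormal D x) =
      resSb D us (x, t) * errPotential u p us ps (x, t) := by
  have hn := h.solution.no_penetration x hx t ht
  rw [energyFlux, inner_add_left, real_inner_smul_left, real_inner_smul_left, inner_sub_left, hn,
    resSb, errPotential]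
  ring

-- Young's inequality on the residual term contributes the 1 and the stretching term (v·∇)u
-- contributes 2G, which together are the Grönwall rate. The divergence term stays linear in the
-- residual, hence the square roots in the final bound.
omit h in
lemma energySource_le {G M : ℝ} (hG : ∀ z ∈ cylinder D T, ‖spaceDeriv u z‖ ≤ G)
    (hM : ∀ z ∈ closedCylinder D T, |errPotential u p us ps z| ≤ M) {z : Space d × ℝ}
    (hz : z ∈ cylinder D T) : energySource f u p us ps z ≤
      (1 + 2 * G) * ‖us z - u z‖ ^ 2 + ‖resVel f us ps z‖ ^ 2 + M * |resDiv us z| := by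
  have e1 : 2 * inner ℝ (us z - u z) (resVel f us ps z) ≤
      ‖us z - u z‖ ^ 2 + ‖resVel f us ps z‖ ^ 2 := by
    nlinarith [real_inner_le_norm (us z - u z) (resVel f us ps z),
      sq_nonneg (‖us z - u z‖ - ‖resVel f us ps z‖)]
  have e2 : -inner ℝ (us z - u z) (spaceDeriv u z (us z - u z)) ≤ G * ‖us z - u z‖ ^ 2 := by
    have h1 := (neg_le_abs _).trans
      (abs_real_inner_le_norm (us z - u z) (spaceDeriv u z (us z - u z)))
    have h2 := (spaceDeriv u z).le_of_opNorm_le (hG z hz) (us z - u z)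
    nlinarith [norm_nonneg (us z - u z)]
  have e3 : resDiv us z * errPotential u p us ps z ≤ M * |resDiv us z| := by
    refine (le_abs_self _).trans ?_
    rw [abs_mul, mul_comm]
    exact mul_le_mul_of_nonneg_right (hM z (cylinder_subset_closedCylinder hz)) (abs_nonneg _)
  rw [energySource]
  linarith

omit h in
lemma errEnergy_nonneg (t : ℝ) : 0 ≤ errEnergy D u us t :=
  integral_nonneg fun x => by positivity

/-- The energy estimate: Grönwall's inequality for the `L²` distance of the velocities. -/
theorem integral_errEnergy_le {G M : ℝ} (hG0 : 0 ≤ G) (hM0 : 0 ≤ M)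
    (hG : ∀ z ∈ cylinder D T, ‖spaceDeriv u z‖ ≤ G)
    (hM : ∀ z ∈ closedCylinder D T, |errPotential u p us ps z| ≤ M)
    (hRu : ContinuousOn (fun z => ‖resVel f us ps z‖ ^ 2) (cylinder D T))
    (hRd : ContinuousOn (fun z => |resDiv us z|) (cylinder D T))
    (hRs : ContinuousOn (fun z => |resSb D us z|) (lateral D T))
    {Bu Bd : ℝ} (hBu : ∀ z ∈ cylinder D T, ‖resVel f us ps z‖ ^ 2 ≤ Bu)
    (hBd : ∀ z ∈ cylinder D T, |resDiv us z| ≤ Bd)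
    {φ : ℕ → Space d → ℝ} {K : ℝ} (hφ : IsCutoffSequence D φ K) :
    ∫ t in (0 : ℝ)..T, errEnergy D u us t ≤
      (T + (1 + 2 * G) * T ^ 2 * Real.exp ((1 + 2 * G) * T)) *
        (errEnergy D u us 0 + (∫ t in (0 : ℝ)..T, ∫ x in D, ‖resVel f us ps (x, t)‖ ^ 2) +
          M * (∫ t in (0 : ℝ)..T, ∫ x in D, |resDiv us (x, t)|) +
          K * (M * ∫ t in (0 : ℝ)..T, ∫ x, |resSb D us (x, t)| ∂(surfaceMeasure D))) := by
  have := h.isFiniteMeasure_restrict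
  have := h.isFiniteMeasure_surface
  have hT := h.time_pos
  have hK := hφ.const_nonneg
  have hDm := ae_restrict_mem (μ := volume) h.isOpen.measurableSet
  obtain ⟨Bv, hBv⟩ := h.exists_normSq_bound
  have hvc := h.continuousOn_normSq.mono (cylinder_subset_closedCylinder (D := D) (T := T))
  obtain ⟨Bs, hBs⟩ := ((isCompact_frontier h.isBounded).prod
    (isCompact_Icc (a := 0) (b := T))).exists_bound_of_continuousOn hRs
  have hlat : frontier D ×ˢ Ioo 0 T ⊆ lateral D T := prod_mono subset_rfl Ioo_subset_Icc_self
  have iv : IntervalIntegrable (errEnergy D u us) volume 0 T :=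
    (h.continuousOn_errEnergy.mono (by rw [uIcc_of_le hT.le])).intervalIntegrable
  have iu : IntervalIntegrable (fun t => ∫ x in D, ‖resVel f us ps (x, t)‖ ^ 2) volume 0 T :=
    intervalIntegrable_spaceTime hT.le h.isOpen.measurableSet hDm hRu (B := Bu) fun z hz => by
      rw [abs_of_nonneg (by positivity)]
      exact hBu z hz
  have idiv : IntervalIntegrable (fun t => ∫ x in D, |resDiv us (x, t)|) volume 0 T :=
    intervalIntegrable_spaceTime hT.le h.isOpen.measurableSet hDm hRd (B := Bd) fun z hz => by
      rw [abs_abs]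
      exact hBd z hz
  have isb : IntervalIntegrable (fun t => ∫ x, |resSb D us (x, t)| ∂(surfaceMeasure D))
      volume 0 T :=
    intervalIntegrable_spaceTime hT.le isClosed_frontier.measurableSet ae_surfaceMeasure_mem
      (hRs.mono hlat) (B := Bs) fun z hz => hBs z (hlat hz)
  set g : Space d × ℝ → ℝ := fun z =>
    (1 + 2 * G) * ‖us z - u z‖ ^ 2 + ‖resVel f us ps z‖ ^ 2 + M * |resDiv us z| with hg
  have hgc : ContinuousOn g (cylinder D T) :=
    ((continuousOn_const.mul hvc).add hRu).add (continuousOn_const.mul hRd)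
  have hg0 : ∀ z ∈ cylinder D T, 0 ≤ g z := fun z _ => by positivity
  -- These bounds serve integrability only and do not enter the estimate.
  have hgB : ∀ z ∈ cylinder D T, |g z| ≤ (1 + 2 * G) * Bv + Bu + M * Bd := by
    intro z hz
    rw [abs_of_nonneg (hg0 z hz)]
    have h1 := hBv z (cylinder_subset_closedCylinder hz)
    have h2 := hBu z hz
    have h3 := hBd z hz
    simp only [hg]
    gcongr
  have hgt : ∀ t ∈ Ioo 0 T, ∫ x in D, g (x, t) = (1 + 2 * G) * errEnergy D u us t +
      (∫ x in D, ‖resVel f us ps (x, t)‖ ^ 2) + M * ∫ x in D, |resDiv us (x, t)| := by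
    intro t ht
    have hint : ∀ (k : Space d × ℝ → ℝ) (B : ℝ), ContinuousOn k (cylinder D T) →
        (∀ z ∈ cylinder D T, |k z| ≤ B) → Integrable (fun x => k (x, t)) (volume.restrict D) := by
      intro k B hk hkB
      refine Integrable.of_bound ((continuousOn_slice hk ht).aestronglyMeasurable
        h.isOpen.measurableSet) B ?_
      filter_upwards [hDm] with x hx using hkB (x, t) ⟨hx, ht⟩
    have i1 := hint _ Bv hvc fun z hz => by
      rw [abs_of_nonneg (by positivity)]
      exact hBv z (cylinder_subset_closedCylinder hz)
    have i2 := hint _ Bu hRu fun z hz => by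
      rw [abs_of_nonneg (by positivity)]
      exact hBu z hz
    have i3 := hint _ Bd hRd fun z hz => by
      rw [abs_abs]
      exact hBd z hz
    have i12 : Integrable (fun x => (1 + 2 * G) * ‖us (x, t) - u (x, t)‖ ^ 2 +
        ‖resVel f us ps (x, t)‖ ^ 2) (volume.restrict D) := (i1.const_mul _).add i2
    simp only [hg]
    rw [integral_add i12 (i3.const_mul M), integral_add (i1.const_mul _) i2,
      integral_const_mul, integral_const_mul, errEnergy]
  set A := errEnergy D u us 0 + (∫ t in (0 : ℝ)..T, ∫ x in D, ‖resVel f us ps (x, t)‖ ^ 2) +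
    M * (∫ t in (0 : ℝ)..T, ∫ x in D, |resDiv us (x, t)|) +
    K * (M * ∫ t in (0 : ℝ)..T, ∫ x, |resSb D us (x, t)| ∂(surfaceMeasure D)) with hA
  have nu : 0 ≤ ∫ t in (0 : ℝ)..T, ∫ x in D, ‖resVel f us ps (x, t)‖ ^ 2 :=
    intervalIntegral.integral_nonneg hT.le fun t _ => integral_nonneg fun x => by positivity
  have nd : 0 ≤ ∫ t in (0 : ℝ)..T, ∫ x in D, |resDiv us (x, t)| :=
    intervalIntegral.integral_nonneg hT.le fun t _ => integral_nonneg fun x => abs_nonneg _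
  have nb : 0 ≤ ∫ t in (0 : ℝ)..T, ∫ x, |resSb D us (x, t)| ∂(surfaceMeasure D) :=
    intervalIntegral.integral_nonneg hT.le fun t _ => integral_nonneg fun x => abs_nonneg _
  have hE0 := errEnergy_nonneg (D := D) (u := u) (us := us)
  have hA0 : 0 ≤ A := by
    have := hE0 0
    positivity
  have hsub : ∀ s t : ℝ, 0 < s → s ≤ t → t < T → uIcc s t ⊆ uIcc 0 T := by
    intro s t hs hst ht
    rw [uIcc_of_le hst, uIcc_of_le hT.le]
    exact Icc_subset_Icc hs.le ht.le
  have hmono : ∀ (k : ℝ → ℝ), (∀ t, 0 ≤ k t) → ∀ {s t r : ℝ}, 0 < s → s ≤ t → t ≤ r →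
      IntervalIntegrable k volume 0 r → ∫ τ in s..t, k τ ≤ ∫ τ in (0 : ℝ)..r, k τ := by
    intro k hk s t r hs hst htr hki
    exact intervalIntegral.integral_mono_interval hs.le hst htr (Eventually.of_forall hk) hki
  -- The equations hold only for times in (0, T), so s stays positive. Subtracting the initial
  -- energy from `A` makes the limit s → 0 restore exactly `A`.
  have hstep : ∀ s t : ℝ, 0 < s → s ≤ t → t < T → errEnergy D u us t ≤ errEnergy D u us s +
      (A - errEnergy D u us 0 + (1 + 2 * G) * ∫ τ in (0 : ℝ)..t, errEnergy D u us τ) := by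
    intro s t hs hst ht
    have hst' : Icc s t ⊆ Ioo 0 T := fun τ hτ => ⟨hs.trans_le hτ.1, hτ.2.trans_lt ht⟩
    have hss := hsub s t hs hst ht
    have hmain := h.errEnergy_le hgc hgB hg0 (fun z hz => energySource_le hG hM hz) hφ hs hst ht
    have e1 : ∫ τ in s..t, ∫ x in D, g (x, τ) = (1 + 2 * G) * (∫ τ in s..t, errEnergy D u us τ) +
        (∫ τ in s..t, ∫ x in D, ‖resVel f us ps (x, τ)‖ ^ 2) +
        M * ∫ τ in s..t, ∫ x in D, |resDiv us (x, τ)| := by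
      rw [← intervalIntegral.integral_const_mul, ← intervalIntegral.integral_const_mul,
        ← intervalIntegral.integral_add ((iv.mono_set hss).const_mul _) (iu.mono_set hss),
        ← intervalIntegral.integral_add (((iv.mono_set hss).const_mul _).add (iu.mono_set hss))
          ((idiv.mono_set hss).const_mul _)]
      refine intervalIntegral.integral_congr fun τ hτ => ?_
      rw [uIcc_of_le hst] at hτ
      exact hgt τ (hst' hτ)
    have e2 : ∫ τ in s..t, ∫ x, |inner ℝ (energyFlux u p us ps (x, τ)) (outwardNormal D x)|
        ∂(surfaceMeasure D) ≤ M * ∫ τ in s..t, ∫ x, |resSb D us (x, τ)| ∂(surfaceMeasure D) := by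
      rw [← intervalIntegral.integral_const_mul]
      refine intervalIntegral.integral_mono_on hst (h.intervalIntegrable_normal_flux.mono_set hss)
        ((isb.mono_set hss).const_mul M) fun τ hτ => ?_
      have hτ' := Ioo_subset_Icc_self (hst' hτ)
      rw [← integral_const_mul]
      refine integral_mono_ae ?_ ?_ ?_
      · exact (continuousOn_slice h.continuousOn_normal_flux hτ').integrableOn_of_subset_isCompact
          (isCompact_frontier h.isBounded) isClosed_frontier.measurableSet subset_rfl
          (by simpa [surfaceMeasure] using (measure_lt_top (surfaceMeasure D) univ).ne)
      · refine Integrable.const_mul ?_ M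
        exact (continuousOn_slice hRs hτ').integrableOn_of_subset_isCompact
          (isCompact_frontier h.isBounded) isClosed_frontier.measurableSet subset_rfl
          (by simpa [surfaceMeasure] using (measure_lt_top (surfaceMeasure D) univ).ne)
      · filter_upwards [ae_surfaceMeasure_mem] with x hx
        rw [h.inner_flux_outwardNormal hx (hst' hτ), abs_mul, mul_comm]
        exact mul_le_mul_of_nonneg_right (hM _ ⟨frontier_subset_closure hx, hτ'⟩) (abs_nonneg _)
    have m1 := hmono _ hE0 hs hst le_rfl (iv.mono_set (by
      rw [uIcc_of_le (hs.le.trans hst), uIcc_of_le hT.le]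
      exact Icc_subset_Icc le_rfl ht.le))
    have m2 := hmono _ (fun τ => integral_nonneg fun x => by positivity) hs hst ht.le iu
    have m3 := hmono _ (fun τ => integral_nonneg fun x => abs_nonneg _) hs hst ht.le idiv
    have m4 := hmono _ (fun τ => integral_nonneg fun x => abs_nonneg _) hs hst ht.le isb
    have n1 : (1 + 2 * G) * (∫ τ in s..t, errEnergy D u us τ) ≤
        (1 + 2 * G) * ∫ τ in (0 : ℝ)..t, errEnergy D u us τ := by gcongr
    have n3 := mul_le_mul_of_nonneg_left m3 hM0
    have n4 := mul_le_mul_of_nonneg_left (e2.trans (mul_le_mul_of_nonneg_left m4 hM0)) hK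
    rw [e1] at hmain
    linarith
  refine integral_le_of_le_add_mul_integral hT.le (by positivity) hA0 h.continuousOn_errEnergy
    (fun t _ => hE0 t) fun t ht => ?_
  rcases ht.1.eq_or_lt with h0 | h0
  · rw [← h0, intervalIntegral.integral_same, mul_zero, add_zero, hA]
    have : 0 ≤ A - errEnergy D u us 0 := by
      have e : A - errEnergy D u us 0 =
        (∫ t in (0 : ℝ)..T, ∫ x in D, ‖resVel f us ps (x, t)‖ ^ 2) +
        M * (∫ t in (0 : ℝ)..T, ∫ x in D, |resDiv us (x, t)|) +
        K * (M * ∫ t in (0 : ℝ)..T, ∫ x, |resSb D us (x, t)| ∂(surfaceMeasure D)) := by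
        rw [hA]
        ring
      rw [e]
      positivity
    linarith
  -- Continuity of the velocities up to t = 0 brings in the initial error.
  · have hc : Tendsto (errEnergy D u us) (𝓝[>] 0) (𝓝 (errEnergy D u us 0)) := by
      refine (h.continuousOn_errEnergy 0 ⟨le_rfl, hT.le⟩).mono_left ?_
      rw [← nhdsWithin_Ioo_eq_nhdsGT hT]
      exact nhdsWithin_mono 0 Ioo_subset_Icc_self
    have hlim := ge_of_tendsto (hc.add_const (A - errEnergy D u us 0 +
      (1 + 2 * G) * ∫ τ in (0 : ℝ)..t, errEnergy D u us τ)) (b := errEnergy D u us t) (by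
        filter_upwards [Ioo_mem_nhdsGT h0] with s hs using hstep s t hs.1 hs.2.le ht.2)
    linarith

end EnergySetting

/-! ### From integrals of squared residuals to training errors. -/

section Quadrature

variable {V F : Type*} [NormedAddCommGroup F] {S : Set V}

lemma QuadRule.sq_trainingError (Q : QuadRule V S) (R : V → F) :
    Q.trainingError R ^ 2 = Q.eval fun y => ‖R y‖ ^ 2 :=
  Real.sq_sqrt (Finset.sum_nonneg fun n _ => mul_nonneg (Q.w_nonneg n) (by positivity))

lemma QuadRule.trainingError_nonneg (Q : QuadRule V S) (R : V → F) : 0 ≤ Q.trainingError R :=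
  Real.sqrt_nonneg _

lemma QuadRule.le_of_abs_sub_le (Q : QuadRule V S) {R : V → F} {I K α : ℝ}
    (h : |I - Q.eval fun y => ‖R y‖ ^ 2| ≤ K * (Q.N : ℝ) ^ (-α)) :
    I ≤ Q.trainingError R ^ 2 + K * (Q.N : ℝ) ^ (-α) := by
  rw [Q.sq_trainingError]
  linarith [(le_abs_self _).trans h]

/-- Subadditivity of the square root. No sign is assumed for `K`: the hypothesis bounds an absolute
value by K times a positive number, so K ≥ 0 follows. -/
lemma QuadRule.sqrt_le_of_abs_sub_le (Q : QuadRule V S) {R : V → F} {I K α : ℝ}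
    (h : |I - Q.eval fun y => ‖R y‖ ^ 2| ≤ K * (Q.N : ℝ) ^ (-α)) :
    Real.sqrt I ≤ Q.trainingError R + Real.sqrt K * (Q.N : ℝ) ^ (-α / 2) := by
  have hN : (0 : ℝ) < Q.N := Nat.cast_pos.2 Q.N_pos
  have hp : (0 : ℝ) < (Q.N : ℝ) ^ (-α) := Real.rpow_pos_of_pos hN _
  have hK : 0 ≤ K := nonneg_of_mul_nonneg_left ((abs_nonneg _).trans h) hp
  have hE := Q.trainingError_nonneg R
  have hs : Real.sqrt (K * (Q.N : ℝ) ^ (-α)) = Real.sqrt K * (Q.N : ℝ) ^ (-α / 2) := by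
    rw [Real.sqrt_mul hK, Real.sqrt_eq_rpow ((Q.N : ℝ) ^ (-α)), ← Real.rpow_mul hN.le]
    ring_nf
  rw [← hs]
  refine (Real.sqrt_le_sqrt (Q.le_of_abs_sub_le h)).trans ?_
  refine Real.sqrt_le_iff.2 ⟨by positivity, ?_⟩
  have := Real.sq_sqrt (mul_nonneg hK hp.le)
  nlinarith [Real.sqrt_nonneg (K * (Q.N : ℝ) ^ (-α))]

end Quadrature

end

end EulerPINN

end

/-! ### Assembly of the error bound. -/

open EulerPINN in
theorem theorem5p1 (d : ℕ) (hd : d = 2 ∨ d = 3) :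
    -- the constant `C_d` depends on the dimension only
    ∃ Cd : ℝ, 0 < Cd ∧
    ∀ D : Set (Space d), IsOpen D → Bornology.IsBounded D → IsConnected D → HasC1Boundary D →
    -- the function `C` that gives `C_0` depends on the domain only
    ∃ C : ℝ → ℝ → ℝ → ℝ → ℝ, (∀ a b a' b', 0 ≤ C a b a' b') ∧
    ∀ (T : ℝ) (_ : 0 < T)
      -- data and classical solution
      (f : Space d × ℝ → Space d) (_ : ContDiffOn ℝ 1 f (cylinder D T))
      (u₀ : Space d → Space d) (u : Space d × ℝ → Space d) (p : Space d × ℝ → ℝ)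
      (_ : IsClassicalSolution D T f u₀ u p)
      (_ : BddAbove ((fun z => ‖spaceDeriv u z‖) '' cylinder D T))
      -- the approximation
      (k : ℕ) (_ : 1 ≤ k)
      (us : Space d × ℝ → Space d) (ps : Space d × ℝ → ℝ)
      (_ : ContDiffOn ℝ k us (cylinder D T)) (_ : ContinuousOn us (closedCylinder D T))
      (_ : ContDiffOn ℝ k ps (cylinder D T)) (_ : ContinuousOn ps (closedCylinder D T))
      -- the squared residuals belong to the classes to which the quadrature bounds apply
      (_ : MemCk k D fun x => ‖resTb u₀ us x‖ ^ 2)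
      (_ : MemCk (k - 1) (cylinder D T) fun z => ‖resVel f us ps z‖ ^ 2)
      (_ : MemCk (k - 1) (cylinder D T) fun z => ‖resDiv us z‖ ^ 2)
      (_ : MemCkRestr k (lateral D T) fun z => ‖resSb D us z‖ ^ 2)
      -- quadrature rules: points, weights, constants and rates
      (Qtb : QuadRule (Space d) D)
      (Qsb : QuadRule (Space d × ℝ) (lateral D T))
      (Qint : QuadRule (Space d × ℝ) (cylinder D T))
      (Ctb Csb Cint : ℝ → ℝ) (αtb αsb αint : ℝ) (_ : 0 < αtb) (_ : 0 < αsb) (_ : 0 < αint)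
      (_ : QuadBoundTb D k Qtb Ctb αtb)
      (_ : QuadBoundSb D T k Qsb Csb αsb)
      (_ : QuadBoundInt D T (k - 1) Qint Cint αint),
      let C₀ := C (supNorm D T u) (supNorm D T us) (supNorm D T p) (supNorm D T ps)
      let Cinf := cInfty Cd D T u
      let Eu := Qint.trainingError (resVel f us ps)
      let Ediv := Qint.trainingError (resDiv us)
      let Esb := Qsb.trainingError (resSb D us)
      let Etb := Qtb.trainingError (resTb u₀ us)
      let Ktb := Ctb (ckNorm k D fun x => ‖resTb u₀ us x‖ ^ 2)
      let Ku := Cint (ckNorm (k - 1) (cylinder D T) fun z => ‖resVel f us ps z‖ ^ 2)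
      let Kdiv := Cint (ckNorm (k - 1) (cylinder D T) fun z => ‖resDiv us z‖ ^ 2)
      let Ksb := Csb (ckNormRestr k (lateral D T) fun z => ‖resSb D us z‖ ^ 2)
      generalizationError D T u us ^ 2 ≤
        (T + Cinf * T ^ 2 * Real.exp (Cinf * T)) *
            (Etb ^ 2 + Eu ^ 2 + C₀ * Real.sqrt T * (Ediv + Esb)) +
          (T + Cinf * T ^ 2 * Real.exp (Cinf * T)) *
            (Ktb * (Qtb.N : ℝ) ^ (-αtb) + Ku * (Qint.N : ℝ) ^ (-αint) +
              C₀ * Real.sqrt T *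
                (Real.sqrt Kdiv * (Qint.N : ℝ) ^ (-αint / 2) +
                  Real.sqrt Ksb * (Qsb.N : ℝ) ^ (-αsb / 2))) := by
  -- C_d = 1 works because ‖∇u‖ is measured in the operator norm, so |v·(v·∇)u| ≤ ‖∇u‖ |v|² without
  -- a dimensional factor.
  refine ⟨1, one_pos, fun D hD hb _ hC => ?_⟩
  obtain ⟨φ, K, hφ⟩ := exists_isCutoffSequence hD hb hC
  have hK := hφ.const_nonneg
  -- The first factor bounds | |v|² + 2(p* - p) |; the second collects the Cauchy–Schwarz masses of
  -- D and ∂D and the flux constant `K`. The absolute values keep the function nonnegative for all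
  -- real arguments.
  refine ⟨fun a b a' b' => ((|a| + |b|) ^ 2 + 2 * (|a'| + |b'|)) *
    (Real.sqrt (volume.real D) + K * Real.sqrt ((surfaceMeasure D).real univ)),
    fun a b a' b' => by positivity, ?_⟩
  intro T hT f hf u₀ u p hsol hgrad k hk us ps hus hus0 hps hps0 mtb mu mdiv msb Qtb Qsb Qint
    Ctb Csb Cint αtb αsb αint _ _ _ qtb qsb qint
  have hk1 : (1 : WithTop ℕ∞) ≤ (k : WithTop ℕ∞) := by exact_mod_cast hk
  have h : EnergySetting D T f u₀ u p us ps := ⟨hD, hb, hC, hT, hf, hsol, hus.of_le hk1, hus0,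
    hps.of_le hk1, hps0⟩
  intro C₀ Cinf Eu Ediv Esb Etb Ktb Ku Kdiv Ksb
  have := h.isFiniteMeasure_restrict
  have := h.isFiniteMeasure_surface
  set M := (|supNorm D T u| + |supNorm D T us|) ^ 2 + 2 * (|supNorm D T p| + |supNorm D T ps|)
    with hM
  have hM0 : 0 ≤ M := by positivity
  have hG : ∀ z ∈ cylinder D T, ‖spaceDeriv u z‖ ≤ gradSupNorm D T u := fun z hz =>
    le_csSup hgrad (mem_image_of_mem _ hz)
  have hG0 : 0 ≤ gradSupNorm D T u := Real.sSup_nonneg (by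
    rintro _ ⟨z, -, rfl⟩
    exact norm_nonneg _)
  have hDm := ae_restrict_mem (μ := volume) hD.measurableSet
  -- Membership in the quadrature classes supplies boundedness of the residuals, which regularity on
  -- the open cylinder alone does not give.
  obtain ⟨cu, Bu, hBu⟩ := mu.continuousOn_and_bounded
  obtain ⟨-, Bd, hBd⟩ := mdiv.continuousOn_and_bounded
  have hBd' : ∀ z ∈ cylinder D T, |resDiv us z| ≤ Real.sqrt Bd := fun z hz =>
    Real.abs_le_sqrt (by simpa using hBd z hz)
  have cd : ContinuousOn (resDiv us) (cylinder D T) :=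
    continuousOn_divergence hD h.velocity_contDiffOn
  have cs : ContinuousOn (fun z => |resSb D us z|) (lateral D T) := by
    obtain ⟨B, G, hG, -, hGc, -⟩ := msb
    refine ((contDiffOn_univ.1 hGc).continuous.sqrt.continuousOn).congr fun z hz => ?_
    simp only [hG hz, Real.norm_eq_abs, Real.sqrt_sq_eq_abs, abs_abs]
  obtain ⟨Bs, hBs⟩ := ((isCompact_frontier hb).prod
    (isCompact_Icc (a := 0) (b := T))).exists_bound_of_continuousOn cs
  have hlat : frontier D ×ˢ Ioo 0 T ⊆ lateral D T := prod_mono subset_rfl Ioo_subset_Icc_self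
  have main := h.integral_errEnergy_le hG0 hM0 hG (fun z hz => h.abs_errPotential_le hz) cu cd.abs
    cs (fun z hz => (le_abs_self _).trans (hBu z hz)) hBd' hφ
  have bdiv := integral_abs_spaceTime_le hT.le hD.measurableSet hDm cd hBd'
  have bsb := integral_abs_spaceTime_le hT.le isClosed_frontier.measurableSet
    ae_surfaceMeasure_mem (cs.mono hlat) (fun z hz => hBs z (hlat hz))
  simp only [abs_abs, sq_abs] at bsb
  rw [measureReal_restrict_apply_univ] at bdiv
  have etb : errEnergy D u us 0 = ∫ x in D, ‖resTb u₀ us x‖ ^ 2 :=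
    setIntegral_congr_fun hD.measurableSet fun x hx => by
      simp only [resTb, hsol.initial x hx]
  have btb := Qtb.le_of_abs_sub_le (qtb _ mtb)
  have bu := Qint.le_of_abs_sub_le (qint _ mu)
  have sdiv : Real.sqrt (∫ t in (0 : ℝ)..T, ∫ x in D, resDiv us (x, t) ^ 2) ≤
      Ediv + Real.sqrt Kdiv * (Qint.N : ℝ) ^ (-αint / 2) := by
    simp only [← Real.norm_eq_abs, ← sq_abs (resDiv us _)]
    exact Qint.sqrt_le_of_abs_sub_le (qint _ mdiv)
  have ssb : Real.sqrt (∫ t in (0 : ℝ)..T, ∫ x, resSb D us (x, t) ^ 2 ∂(surfaceMeasure D)) ≤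
      Esb + Real.sqrt Ksb * (Qsb.N : ℝ) ^ (-αsb / 2) := by
    simp only [← Real.norm_eq_abs, ← sq_abs (resSb D us _)]
    exact Qsb.sqrt_le_of_abs_sub_le (qsb _ msb)
  have hgen : generalizationError D T u us ^ 2 = ∫ t in (0 : ℝ)..T, errEnergy D u us t := by
    rw [generalizationError, Real.sq_sqrt]
    · simp only [errEnergy, norm_sub_rev]
    · exact intervalIntegral.integral_nonneg hT.le fun t _ =>
        integral_nonneg fun x => by positivity
  have hCinf : Cinf = 1 + 2 * gradSupNorm D T u := by simp [Cinf, cInfty]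
  rw [hgen, ← mul_add, hCinf]
  refine main.trans (mul_le_mul_of_nonneg_left ?_ (by positivity))
  rw [etb]
  set X := Ediv + Real.sqrt Kdiv * (Qint.N : ℝ) ^ (-αint / 2) with hX
  set Y := Esb + Real.sqrt Ksb * (Qsb.N : ℝ) ^ (-αsb / 2) with hY
  have hX0 : 0 ≤ X := (Real.sqrt_nonneg _).trans sdiv
  have hY0 : 0 ≤ Y := (Real.sqrt_nonneg _).trans ssb
  have b1 : M * (∫ t in (0 : ℝ)..T, ∫ x in D, |resDiv us (x, t)|) ≤
      M * (Real.sqrt T * Real.sqrt (volume.real D) * X) := by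
    refine mul_le_mul_of_nonneg_left (bdiv.trans ?_) hM0
    gcongr
  have b2 : K * (M * ∫ t in (0 : ℝ)..T, ∫ x, |resSb D us (x, t)| ∂(surfaceMeasure D)) ≤
      K * (M * (Real.sqrt T * Real.sqrt ((surfaceMeasure D).real univ) * Y)) := by
    refine mul_le_mul_of_nonneg_left (mul_le_mul_of_nonneg_left (bsb.trans ?_) hM0) hK
    gcongr
  -- The product form of C₀ adds two cross terms, pairing each mass with the other residual; they
  -- are nonnegative and only enlarge the right-hand side.
  have b3 : M * (Real.sqrt T * Real.sqrt (volume.real D) * X) +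
      K * (M * (Real.sqrt T * Real.sqrt ((surfaceMeasure D).real univ) * Y)) ≤
      C₀ * Real.sqrt T * (X + Y) := by
    have e : C₀ * Real.sqrt T * (X + Y) = M * (Real.sqrt T * Real.sqrt (volume.real D) * X) +
        K * (M * (Real.sqrt T * Real.sqrt ((surfaceMeasure D).real univ) * Y)) +
        (M * (Real.sqrt T * Real.sqrt (volume.real D) * Y) +
        K * (M * (Real.sqrt T * Real.sqrt ((surfaceMeasure D).real univ) * X))) := by
      change M * (Real.sqrt (volume.real D) + K * Real.sqrt ((surfaceMeasure D).real univ)) *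
        Real.sqrt T * (X + Y) = _
      ring
    rw [e]
    exact le_add_of_nonneg_right (by positivity)
  calc _ ≤ (Etb ^ 2 + Ktb * (Qtb.N : ℝ) ^ (-αtb)) + (Eu ^ 2 + Ku * (Qint.N : ℝ) ^ (-αint)) +
        C₀ * Real.sqrt T * (X + Y) := by linarith
    _ = _ := by
        rw [hX, hY]
        ring
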